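/- Let $G$ be a (discrete) group with identity $e$ and let $1<p<\infty$. Let $\lambda_p,\rho_p$ be the left and right regular representations of $G$ on the complex space $\ell^p(G)$, $(\lambda_p(t)\xi)(g)=\xi(t^{-1}g)$, $(\rho_p(t)\xi)(g)=\xi(gt)$. The weak*-topology on $B(\ell^p(G))$ is the one it carries as the dual of $\ell^{p'}(G)\,\widehat{\otimes}\,\ell^p(G)$ ($1/p+1/p'=1$), with duality $\langle \sum_j y_j\otimes x_j,T\rangle=\sum_j\langle y_j,Tx_j\rangle$. Put $$CV_p(G)=\{T\in B(\ell^p(G)) : T\rho_p(t)=\rho_p(t)T\ (t\in G)\},\qquad PM_p(G)=\overline{\operatorname{span}}^{\,w^*}\lambda_p(G).$$ Call $G$ ICC if every conjugacy class other than $\{e\}$ is infinite, and let $FC(G)$ be the set of elements with finite conjugacy class. Let $\mathcal A$ be a weak*-closed subalgebra of $B(\ell^p(G))$ with $PM_p(G)\subset\mathcal A\subset CV_p(G)$. Call $\mathcal A$ weak*-simple if its only weak*-closed two-sided ideals are $\{0\}$ and $\mathcal A$. Then $\mathcal A$ is weak*-simple if and only if $G$ is ICC. Moreover, if $G$ is not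 ICC, then at least one of the following holds. 1. There is a finite normal subgroup $N\neq\{e\}$ of $G$ such that $P=\frac1{|N|}\sum_{t\in N}\lambda_p(t)$ is a central idempotent of $\mathcal A$, and $\mathcal AP$ is a weak*-closed two-sided ideal of $\mathcal A$ with $\{0\}\neq\mathcal AP\neq\mathcal A$. 2. There are a normal subgroup $N\subset FC(G)$ of $G$ with $N\cong\mathbb Z^n$ for some $n\ge1$, and a norm-closed ideal $K$ of $CV_p(N)$, such that $$I=\{T\in\mathcal A : \Phi(v)T=0 \text{ for all } \Phi\in\operatorname{Hom}_{CV_p(N)}(K,CV_p(G)) \text{ and all } v\in K\}$$ is a weak*-closed two-sided ideal of $\mathcal A$ with $\{0\}\neq I\neq\mathcal A$. Here $\operatorname{Hom}_{CV_p(N)}(K,CV_p(G))$ is the set of bounded linear maps $\Phi:K\to CV_p(G)$ with $\Phi(Sv)=S\,\Phi(v)$ for $S\in CV_p(N)$, $v\in K$; and $CV_p(N)$ is regarded as a subalgebra of $CV_p(G)$ by letting $S$ act on every right coset of $N$: $(S\xi)(ut)=(S\xi_t)(u)$, where $\xi_t(u)=\xi(ut)$, for $u\in N$, $t\in G$. 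-/

import Mathlib

open scoped ENNReal Topology

noncomputable section

namespace ConvOp

/-! ### Groups -/

/-- `G` is ICC: every conjugacy class other than that of the identity is infinite. -/
def IsICC (G : Type*) [Group G] : Prop :=
  ∀ g : G, g ≠ 1 → (conjugatesOf g).Infinite

/-- The FC-centre of `G`: the elements with finite conjugacy class. -/
def fcCentre (G : Type*) [Group G] : Set G :=
  {g | (conjugatesOf g).Finite}

/-! ### The spaces `ℓ^p` and their bounded operators -/

/-- The complex Banach space `ℓ^p(G)`. -/
abbrev Ell (p : ℝ≥0∞) (G : Type*) : Type _ := lp (fun _ : G => ℂ) p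

/-- The algebra `B(ℓ^p(G))` of bounded linear operators. -/
abbrev Op (p : ℝ≥0∞) [Fact (1 ≤ p)] (G : Type*) : Type _ := Ell p G →L[ℂ] Ell p G

theorem memlp_comp {p : ℝ≥0∞} [Fact (1 ≤ p)] {G H : Type*} {f : H → G}
    (hf : Function.Injective f) (x : Ell p G) :
    Memℓp (E := fun _ : H => ℂ) (fun h => x (f h)) p := by
  rcases p.dichotomy with rfl | hp
  · refine memℓp_infty ((lp.memℓp x).bddAbove.mono ?_)
    rintro _ ⟨h, rfl⟩
    exact ⟨f h, rfl⟩
  · exact memℓp_gen (((lp.memℓp x).summable (by linarith)).comp_injective hf)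

/-- Composition `x ↦ x ∘ f` with an injective map `f`, as an operator `ℓ^p(G) → ℓ^p(H)`. -/
def compOp (p : ℝ≥0∞) [Fact (1 ≤ p)] {G H : Type*} (f : H → G) (hf : Function.Injective f) :
    Ell p G →L[ℂ] Ell p H :=
  LinearMap.mkContinuous
    { toFun := fun x => ⟨fun h => x (f h), memlp_comp hf x⟩
      map_add' := fun _ _ => rfl
      map_smul' := fun _ _ => rfl } 1 (by
    intro x
    rw [one_mul]
    rcases p.dichotomy with rfl | hp
    · exact lp.norm_le_of_forall_le (norm_nonneg x)
        fun h => lp.norm_apply_le_norm (by simp) x (f h)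
    · have hp0 : 0 < p.toReal := by linarith
      refine lp.norm_le_of_tsum_le hp0 (norm_nonneg x) ?_
      rw [lp.norm_rpow_eq_tsum hp0 x]
      exact (((lp.memℓp x).summable hp0).comp_injective hf).tsum_le_tsum_of_inj f hf
        (fun _ _ => by positivity) (fun _ => le_rfl) ((lp.memℓp x).summable hp0))

@[simp] theorem compOp_apply (p : ℝ≥0∞) [Fact (1 ≤ p)] {G H : Type*} (f : H → G)
    (hf : Function.Injective f) (x : Ell p G) (h : H) : compOp p f hf x h = x (f h) := rfl

/-- The left regular representation, `(λ_p(t) ξ)(g) = ξ(t⁻¹ g)`. -/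
def leftReg (p : ℝ≥0∞) [Fact (1 ≤ p)] {G : Type*} [Group G] (t : G) : Op p G :=
  compOp p (fun g => t⁻¹ * g) (mul_right_injective t⁻¹)

/-- The right regular representation, `(ρ_p(t) ξ)(g) = ξ(g t)`. -/
def rightReg (p : ℝ≥0∞) [Fact (1 ≤ p)] {G : Type*} [Group G] (t : G) : Op p G :=
  compOp p (fun g => g * t) (mul_left_injective t)

/-! ### The weak*-topology of `B(ℓ^p(G))` -/

instance (p : ℝ≥0∞) [Fact (1 ≤ p)] : Fact (1 ≤ p.conjExponent) :=
  ⟨by simp [ENNReal.conjExponent]⟩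

/-- The pairing `⟨y, x⟩ = ∑ y(g) x(g)` of `ℓ^{p'}(G)` with `ℓ^p(G)`. -/
def pairing {p : ℝ≥0∞} {G : Type*} (y : Ell p.conjExponent G) (x : Ell p G) : ℂ :=
  ∑' g : G, y g * x g

/-- The weak*-topology on `B(ℓ^p(G))` as the dual of the projective tensor product of
`ℓ^{p'}(G)` and `ℓ^p(G)`.  The elements of this tensor product are the sums `∑ y_j ⊗ x_j` with
`∑ ‖y_j‖ ‖x_j‖ < ∞`, and such a sum acts on `T` by `∑ ⟨y_j, T x_j⟩`; the topology is the coarsest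
one that makes all these functionals continuous. -/
@[reducible] def weakStar (p : ℝ≥0∞) [Fact (1 ≤ p)] (G : Type*) : TopologicalSpace (Op p G) :=
  ⨅ (y : ℕ → Ell p.conjExponent G) (x : ℕ → Ell p G) (_ : Summable fun j => ‖y j‖ * ‖x j‖),
    TopologicalSpace.induced (fun T : Op p G => ∑' j, pairing (y j) (T (x j))) inferInstance

/-! ### Convolution operators and pseudomeasures -/

/-- The algebra `CV_p(G)` of `p`-convolution operators: the commutant of `ρ_p(G)`. -/
def CV (p : ℝ≥0∞) [Fact (1 ≤ p)] (G : Type*) [Group G] : Subalgebra ℂ (Op p G) :=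
  Subalgebra.centralizer ℂ (Set.range (rightReg p (G := G)))

/-- The `p`-pseudomeasures `PM_p(G)`: the weak*-closed linear span of `λ_p(G)`. -/
def PM (p : ℝ≥0∞) [Fact (1 ≤ p)] (G : Type*) [Group G] : Set (Op p G) :=
  closure[weakStar p G] (Submodule.span ℂ (Set.range (leftReg p (G := G))) : Set (Op p G))

/-! ### Weak*-closed ideals -/

/-- A two-sided ideal `I` of an algebra `A` of operators on `ℓ^p(G)` is weak*-closed. -/
def IsWeakStarClosedIdeal {p : ℝ≥0∞} [Fact (1 ≤ p)] {G : Type*} {A : Subalgebra ℂ (Op p G)}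
    (I : TwoSidedIdeal A) : Prop :=
  IsClosed[weakStar p G] ((fun T : A => (T : Op p G)) '' (I : Set A))

/-- `A` has no proper, non-zero, weak*-closed two-sided ideal. -/
def IsWeakStarSimple {p : ℝ≥0∞} [Fact (1 ≤ p)] {G : Type*} (A : Subalgebra ℂ (Op p G)) : Prop :=
  ∀ I : TwoSidedIdeal A, IsWeakStarClosedIdeal I → I = ⊥ ∨ I = ⊤

/-- The averaging operator `λ_p(|N|⁻¹ 1_N)` of a (finite) subgroup `N`. -/
def avg (p : ℝ≥0∞) [Fact (1 ≤ p)] {G : Type*} [Group G] (N : Subgroup G) : Op p G :=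
  (Nat.card N : ℂ)⁻¹ • ∑ᶠ t : N, leftReg p (t : G)

/-! ### The inclusion of `CV_p(N)` into `CV_p(G)` -/

section Extension

variable {p : ℝ≥0∞} [Fact (1 ≤ p)] {G : Type*} [Group G]

theorem mem_CV_iff {T : Op p G} :
    T ∈ CV p G ↔ ∀ (t : G) (x : Ell p G), T (rightReg p t x) = rightReg p t (T x) := by
  simp only [CV, Subalgebra.mem_centralizer_iff, Set.forall_mem_range]
  refine forall_congr' fun t => ?_
  rw [ContinuousLinearMap.ext_iff]
  exact forall_congr' fun x => eq_comm

/-- The function `u ↦ ξ(u g)` on the subgroup `N`. -/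
def slice (p : ℝ≥0∞) [Fact (1 ≤ p)] (N : Subgroup G) (g : G) : Ell p G →L[ℂ] Ell p N :=
  compOp p (fun u : N => (u : G) * g) fun _ _ h => Subtype.ext (mul_right_cancel h)

theorem slice_apply (N : Subgroup G) (g : G) (x : Ell p G) (u : N) :
    slice p N g x u = x ((u : G) * g) := rfl

theorem rightReg_apply (t : G) (x : Ell p G) (g : G) : rightReg p t x g = x (g * t) := rfl

theorem slice_mul (N : Subgroup G) (S : CV p N) (x : Ell p G) (u : N) (t : G) :
    (S : Op p N) (slice p N ((u : G) * t) x) 1 = (S : Op p N) (slice p N t x) u := by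
  have h : slice p N ((u : G) * t) x = rightReg p u (slice p N t x) := by
    ext v
    simp only [slice_apply, rightReg_apply, Subgroup.coe_mul, mul_assoc]
  rw [h, mem_CV_iff.1 S.2, rightReg_apply, one_mul]

/-- A right transversal `q ↦ t_q` of `N` identifies `G` with the pairs `(q, u)`, as `g = u t_q`. -/
def cosetEquiv (N : Subgroup G) : Quotient (QuotientGroup.rightRel N) × N ≃ G :=
  Equiv.ofBijective (fun z => (z.2 : G) * z.1.out) (by
    constructor
    · rintro ⟨q, u⟩ ⟨r, v⟩ h
      simp only at h
      have hqr : q = r := by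
        rw [← Quotient.out_eq q, ← Quotient.out_eq r]
        refine Quotient.sound ?_
        change QuotientGroup.rightRel N _ _
        rw [QuotientGroup.rightRel_apply]
        have : r.out * q.out⁻¹ = ((v⁻¹ * u : N) : G) := by
          rw [mul_inv_eq_iff_eq_mul, Subgroup.coe_mul, mul_assoc, h]
          simp
        rw [this]
        exact Subtype.property _
      subst hqr
      have := mul_right_cancel h
      rw [Subtype.ext this]
    · intro g
      have h : QuotientGroup.rightRel N
          (Quotient.mk (QuotientGroup.rightRel N) g).out g := Quotient.mk_out g
      rw [QuotientGroup.rightRel_apply] at h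
      exact ⟨(Quotient.mk _ g, ⟨_, h⟩), by simp⟩)

theorem summable_tsum_prod_le {ι κ : Type*} {f g : ι × κ → ℝ} (hf0 : ∀ z, 0 ≤ f z) (hg : Summable g)
    (hg0 : ∀ z, 0 ≤ g z) {C : ℝ} (hf : ∀ i, Summable fun k => f (i, k))
    (hfg : ∀ i, ∑' k, f (i, k) ≤ C * ∑' k, g (i, k)) :
    Summable f ∧ ∑' z, f z ≤ C * ∑' z, g z := by
  have hg' := (summable_prod_of_nonneg hg0).1 hg
  have hq : Summable fun i => ∑' k, f (i, k) :=
    Summable.of_nonneg_of_le (fun i => tsum_nonneg fun k => hf0 _) hfg (hg'.2.mul_left _)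
  have hs : Summable f := (summable_prod_of_nonneg hf0).2 ⟨hf, hq⟩
  refine ⟨hs, ?_⟩
  rw [hs.tsum_prod' hf, hg.tsum_prod' hg'.1, ← tsum_mul_left]
  exact hq.tsum_le_tsum hfg (hg'.2.mul_left _)

theorem extend_aux (hp : p ≠ ∞) (N : Subgroup G) (S : CV p N) (x : Ell p G) :
    (Summable fun g : G => ‖(S : Op p N) (slice p N g x) 1‖ ^ p.toReal) ∧
      ∑' g : G, ‖(S : Op p N) (slice p N g x) 1‖ ^ p.toReal ≤ (‖(S : Op p N)‖ * ‖x‖) ^ p.toReal := by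
  have hp0 : 0 < p.toReal :=
    ENNReal.toReal_pos (zero_lt_one.trans_le (Fact.out : 1 ≤ p)).ne' hp
  obtain ⟨e, he⟩ : ∃ e : Quotient (QuotientGroup.rightRel N) × N ≃ G,
      ∀ q u, e (q, u) = (u : G) * q.out := ⟨cosetEquiv N, fun _ _ => rfl⟩
  have hF : ∀ q u, ‖(S : Op p N) (slice p N (e (q, u)) x) 1‖ ^ p.toReal =
      ‖(S : Op p N) (slice p N q.out x) u‖ ^ p.toReal := by
    intro q u
    rw [he, slice_mul]
  have hX : ∀ q u, ‖x (e (q, u))‖ ^ p.toReal = ‖slice p N q.out x u‖ ^ p.toReal := by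
    intro q u
    rw [he, slice_apply]
  have key := summable_tsum_prod_le (C := ‖(S : Op p N)‖ ^ p.toReal)
    (f := fun z => ‖(S : Op p N) (slice p N (e z) x) 1‖ ^ p.toReal)
    (g := fun z => ‖x (e z)‖ ^ p.toReal) (fun z => by positivity)
    (e.summable_iff.2 ((lp.memℓp x).summable hp0)) (fun z => by positivity)
    (fun q => by
      simp only [hF]
      exact (lp.memℓp _).summable hp0)
    (fun q => by
      simp only [hF, hX]
      rw [← lp.norm_rpow_eq_tsum hp0, ← lp.norm_rpow_eq_tsum hp0,
        ← Real.mul_rpow (norm_nonneg _) (norm_nonneg _)]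
      exact Real.rpow_le_rpow (norm_nonneg _) (ContinuousLinearMap.le_opNorm _ _) hp0.le)
  rw [Real.mul_rpow (norm_nonneg _) (norm_nonneg _), lp.norm_rpow_eq_tsum hp0 x,
    ← e.tsum_eq (fun g => ‖x g‖ ^ p.toReal), ← e.tsum_eq, ← e.summable_iff]
  exact key

/-- The extension of `S ∈ CV_p(N)` to an operator on `ℓ^p(G)`, acting as `S` on each right coset of
`N`: for a right transversal `𝒯` of `N` and `ξ_t(u) = ξ(u t)`, one has `(S ξ)(u t) = (S ξ_t)(u)` for
`u ∈ N` and `t ∈ 𝒯`.  As `S` commutes with right translations, this is the formula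
`(S ξ)(g) = (S ξ_g)(1)` used here, which does not mention `𝒯`. -/
def extendOp (hp : p ≠ ∞) (N : Subgroup G) (S : CV p N) : Op p G :=
  LinearMap.mkContinuous
    { toFun := fun x => ⟨fun g => (S : Op p N) (slice p N g x) 1,
        memℓp_gen (extend_aux hp N S x).1⟩
      map_add' := fun x y => by
        ext g
        simp only [map_add]
        rfl
      map_smul' := fun c x => by
        ext g
        simp only [map_smul]
        rfl } ‖(S : Op p N)‖ (by
    intro x
    exact lp.norm_le_of_tsum_le
      (ENNReal.toReal_pos (zero_lt_one.trans_le (Fact.out : 1 ≤ p)).ne' hp) (by positivity)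
      (extend_aux hp N S x).2)

theorem extendOp_apply (hp : p ≠ ∞) (N : Subgroup G) (S : CV p N) (x : Ell p G) (g : G) :
    extendOp hp N S x g = (S : Op p N) (slice p N g x) 1 := rfl

theorem extendOp_apply_mul (hp : p ≠ ∞) (N : Subgroup G) (S : CV p N) (x : Ell p G) (u : N)
    (t : G) : extendOp hp N S x ((u : G) * t) = (S : Op p N) (slice p N t x) u := by
  rw [extendOp_apply, slice_mul]

theorem extendOp_mem (hp : p ≠ ∞) (N : Subgroup G) (S : CV p N) : extendOp hp N S ∈ CV p G := by
  refine mem_CV_iff.2 fun t x => ?_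
  ext g
  have h : slice p N g (rightReg p t x) = slice p N (g * t) x := by
    ext v
    simp only [slice_apply, rightReg_apply, mul_assoc]
  rw [extendOp_apply, h]
  rfl

/-- The inclusion `CV_p(N) → CV_p(G)`. -/
def extend (hp : p ≠ ∞) (N : Subgroup G) (S : CV p N) : CV p G :=
  ⟨extendOp hp N S, extendOp_mem hp N S⟩

/-- `Hom_{CV_p(N)}(K, CV_p(G))` for a left ideal `K` of `CV_p(N)`: the bounded linear maps
`Φ : K → CV_p(G)` with `Φ(S v) = S Φ(v)` for all `S ∈ CV_p(N)` and `v ∈ K`, where `CV_p(N)` acts on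
`CV_p(G)` by multiplication on the left. -/
def HomCV (hp : p ≠ ∞) (N : Subgroup G) (K : Ideal (CV p N)) : Set (K →L[ℂ] CV p G) :=
  {Φ | ∀ (S : CV p N) (v : K), Φ ⟨S * v, K.mul_mem_left S v.2⟩ = extend hp N S * Φ v}

/-- The annihilator of the right `CV_p(G)`-module `Hom_{CV_p(N)}(K, CV_p(G))`, whose action is
`(Φ · T)(v) = Φ(v) T`. -/
def annHomCV (hp : p ≠ ∞) (N : Subgroup G) (K : Ideal (CV p N)) : Set (CV p G) :=
  {T | ∀ Φ ∈ HomCV hp N K, ∀ v : K, Φ v * T = 0}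

end Extension

end ConvOp

end

open scoped ENNReal Topology

noncomputable section

namespace ConvOp

/-! ### Point masses and the duality of `ℓ^p` with `ℓ^{p'}`. -/

section Basic

/-! A convolution operator `T` is determined by the function `T δ_1`, and conjugating `T` by `λ(t)`
conjugates the argument of this function by `t`. Suppose `G` is ICC and `I` is a non-zero
weak*-closed ideal. A left translate of a non-zero element of `I` has non-zero coefficient `c` at
the identity. By B. H. Neumann's lemma on coset coverings, every finite set can be conjugated off
itself apart from the identity (`IsICC.exists_conj_notMem`). Functions in `ℓ^p` vanish at infinity,
so the corresponding bounded net of conjugates converges weak* to `c • 1` (`IsICC.exists_tendsto`),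
and `I` contains the identity operator.

If `G` is not ICC, it has a non-trivial normal subgroup `N` that is finite, or is free abelian of
finite rank inside the FC-centre (`exists_normal_of_not_isICC`). In either case `N` yields a
non-zero element that is central in `CV_p(G)`. Commuting with the left translations does not
obviously give commutation with all of `CV_p(G)`; it does for elements that have a counterpart in
the commutant of `CV_p(G)` with the same value at `δ_1` (`commute_of_mem_biRegular`), as every
absolutely summable combination of left translations has.

For finite `N` the central element is the averaging idempotent. For free abelian `N`, take `f, h ∈
ℓ^1(ℤ)` with `f * h = 0`, `∑ f = 1` and `h ≠ 0` (`exists_summable_convolution_eq_zero`). For `s ∈ N`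
of infinite order let `W` be the product, over the finitely many conjugates `c` of `s`, of `∑ f(k)
λ(c^k)`. Conjugation permutes the factors, so `W` is central. It is non-zero because the coefficient
sum is multiplicative and equals `1`. Its annihilator `K` in `CV_p(N)` contains `∑ h(k) λ(s^k) ≠ 0`.
Then `Φ(v) W = W Φ(v) = Φ(W v) = 0` puts `W` into the ideal defined by `K`, while the inclusion of
`K` into `CV_p(G)` keeps the identity out of it. -/

theorem conjExponent_ne_top {p : ℝ≥0∞} (hp₁ : 1 < p) : p.conjExponent ≠ ∞ := by
  simp only [ENNReal.conjExponent, ne_eq, ENNReal.add_eq_top, ENNReal.one_ne_top, false_or,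
    ENNReal.inv_eq_top, tsub_eq_zero_iff_le, not_le]
  exact hp₁

/-- The point mass at `g`. -/
def delta (p : ℝ≥0∞) {X : Type*} (g : X) : Ell p X :=
  open Classical in lp.single p g 1

open Classical in
theorem delta_apply {p : ℝ≥0∞} {X : Type*} (g h : X) :
    delta p g h = if h = g then 1 else 0 := by
  simp [delta, Pi.single_apply]

theorem delta_apply_self {p : ℝ≥0∞} {X : Type*} (g : X) : delta p g g = 1 := by
  simp [delta_apply]

theorem delta_apply_of_ne {p : ℝ≥0∞} {X : Type*} {g h : X} (hgh : h ≠ g) : delta p g h = 0 := by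
  simp [delta_apply, hgh]

variable {p : ℝ≥0∞}

theorem smul_delta {X : Type*} [DecidableEq X] (g : X) (c : ℂ) :
    c • delta p g = lp.single p g c := by
  ext h
  by_cases hh : h = g <;> simp [delta_apply, hh]

theorem pairing_delta_left {X : Type*} (g : X) (x : Ell p X) :
    pairing (delta p.conjExponent g) x = x g := by
  rw [pairing, tsum_eq_single g fun h hh => by rw [delta_apply_of_ne hh, zero_mul],
    delta_apply_self, one_mul]

theorem pairing_delta_right {X : Type*} (y : Ell p.conjExponent X) (g : X) :
    pairing y (delta p g) = y g := by
  rw [pairing, tsum_eq_single g fun h hh => by rw [delta_apply_of_ne hh, mul_zero],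
    delta_apply_self, mul_one]

variable [Fact (1 ≤ p)]

theorem holderConjugate_toReal (hp₁ : 1 < p) (hp : p ≠ ∞) :
    p.toReal.HolderConjugate p.conjExponent.toReal :=
  ENNReal.HolderConjugate.toReal_of_ne_top hp (conjExponent_ne_top hp₁)

theorem norm_delta {X : Type*} (g : X) : ‖delta p g‖ = 1 := by
  classical
  simp [delta, lp.norm_single (zero_lt_one.trans_le (Fact.out : 1 ≤ p))]

theorem hasSum_delta {X : Type*} (hp : p ≠ ∞) (x : Ell p X) :
    HasSum (fun g => x g • delta p g) x := by
  classical
  simpa only [smul_delta] using lp.hasSum_single hp x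

/-- A continuous linear map on `ℓ^p(X)` is determined by its values on point masses. -/
theorem clm_ext {X E : Type*} [NormedAddCommGroup E] [NormedSpace ℂ E] (hp : p ≠ ∞)
    {S T : Ell p X →L[ℂ] E} (h : ∀ g, S (delta p g) = T (delta p g)) : S = T := by
  ext1 x
  have h1 := (hasSum_delta hp x).mapL S
  have h2 := (hasSum_delta hp x).mapL T
  simp only [map_smul, h] at h1 h2
  exact h1.unique h2

/-- Evaluation at a point, as a functional on `ℓ^p(X)`. -/
def evalAt (p : ℝ≥0∞) [Fact (1 ≤ p)] {X : Type*} (g : X) : Ell p X →L[ℂ] ℂ :=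
  LinearMap.mkContinuous
    { toFun := fun x => x g
      map_add' := fun _ _ => rfl
      map_smul' := fun _ _ => rfl } 1 fun x => by
    rw [one_mul]
    exact lp.norm_apply_le_norm (zero_lt_one.trans_le (Fact.out : 1 ≤ p)).ne' x g

/-- The pairing as a bounded bilinear map. -/
def pairingL (p : ℝ≥0∞) [Fact (1 ≤ p)] (X : Type*) :
    Ell p.conjExponent X →L[ℂ] Ell p X →L[ℂ] ℂ :=
  haveI : p.conjExponent.HolderConjugate p := ENNReal.HolderConjugate.symm (p := p)
  lp.dualPairing p.conjExponent p (fun _ => ContinuousLinearMap.mul ℂ ℂ) (K := 1)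
    fun _ => ContinuousLinearMap.opNorm_mul_le ℂ ℂ

theorem pairingL_apply {X : Type*} (y : Ell p.conjExponent X) (x : Ell p X) :
    pairingL p X y x = pairing y x := rfl

theorem norm_pairing_le {X : Type*} (y : Ell p.conjExponent X) (x : Ell p X) :
    ‖pairing y x‖ ≤ ‖y‖ * ‖x‖ := by
  rw [← pairingL_apply]
  refine ((pairingL p X).le_opNorm₂ y x).trans ?_
  have : ‖pairingL p X‖ ≤ 1 := lp.norm_dualPairing _ _
  rw [mul_assoc]
  exact mul_le_of_le_one_left (by positivity) this

/-- Every bounded functional on `ℓ^p(X)` is the pairing with an element of `ℓ^{p'}(X)`. -/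
theorem exists_pairing_eq {X : Type*} (hp₁ : 1 < p) (hp : p ≠ ∞) (φ : Ell p X →L[ℂ] ℂ) :
    ∃ y : Ell p.conjExponent X, ∀ x, φ x = pairing y x := by
  classical
  have hpq := holderConjugate_toReal hp₁ hp
  have hmem : Memℓp (E := fun _ : X => ℂ) (fun g => φ (delta p g)) p.conjExponent := by
    refine memℓp_gen' (C := ‖φ‖ ^ p.conjExponent.toReal) fun s => ?_
    -- `a` attains equality in Hölder's inequality on `s`. Corrected by the phases `u`, it gives a
    -- test vector `x` in the unit ball at which `φ` equals the `ℓ^{p'}`-norm of the coefficients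
    -- over `s`.
    obtain ⟨⟨a, ha, ha'⟩, -⟩ := NNReal.isGreatest_Lp s (fun g => ‖φ (delta p g)‖₊) hpq.symm
    change ∑ g ∈ s, a g ^ p.toReal ≤ 1 at ha
    have hsgn : ∀ z : ℂ, ∃ u : ℂ, ‖u‖ ≤ 1 ∧ u * z = ‖z‖ := fun z => by
      by_cases hz : z = 0
      · exact ⟨0, by simp [hz]⟩
      · exact ⟨‖z‖ / z, by simp [hz], by field_simp⟩
    choose u hu hu' using hsgn
    set x : Ell p X := ∑ g ∈ s, lp.single p g ((a g : ℂ) * u (φ (delta p g))) with hx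
    have hnx : ‖x‖ ≤ 1 := by
      have h1 : ‖x‖ ^ p.toReal ≤ 1 := by
        rw [hx, lp.norm_sum_single hpq.pos
          (fun g => ((a g : ℂ) * u (φ (delta p g)))) s]
        refine (Finset.sum_le_sum (g := fun g => (a g : ℝ) ^ p.toReal) fun g _ => ?_).trans
          (by exact_mod_cast ha)
        rw [norm_mul]
        refine Real.rpow_le_rpow (by positivity) ?_ hpq.nonneg
        simpa using mul_le_of_le_one_right (a g).2 (hu _)
      by_contra! hlt
      exact absurd h1 (not_le.2 (Real.one_lt_rpow hlt hpq.pos))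
    have hφx : φ x = ((∑ g ∈ s, ‖φ (delta p g)‖₊ * a g : NNReal) : ℂ) := by
      rw [hx, map_sum]
      push_cast
      refine Finset.sum_congr rfl fun g _ => ?_
      rw [← smul_delta, map_smul, smul_eq_mul, mul_assoc, hu', mul_comm]
    have hle : ((∑ g ∈ s, ‖φ (delta p g)‖₊ * a g : NNReal) : ℝ) ≤ ‖φ‖ := by
      have := φ.le_opNorm x
      rw [hφx] at this
      rw [Complex.norm_real, Real.norm_of_nonneg (by positivity)] at this
      exact this.trans (mul_le_of_le_one_right (norm_nonneg _) hnx)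
    beta_reduce at ha'
    rw [ha'] at hle
    push_cast at hle
    have h3 := Real.rpow_le_rpow (by positivity) hle hpq.symm.nonneg
    rwa [← Real.rpow_mul (by positivity), one_div, inv_mul_cancel₀ hpq.symm.ne_zero,
      Real.rpow_one] at h3
  refine ⟨⟨_, hmem⟩, fun x => ?_⟩
  rw [← pairingL_apply]
  refine DFunLike.congr_fun (clm_ext hp fun g => ?_) x
  rw [pairingL_apply, pairing_delta_right]

end Basic

/-! ### Convergence and closed sets in the weak*-topology. -/

section WeakStar

open Filter

variable {p : ℝ≥0∞} [Fact (1 ≤ p)]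

/-- An `ε/3`-type argument: the uniform bound makes the error from replacing `x` by `x'` independent
of `i`. The approximant may depend on `ε`, so a dense set of good points suffices. -/
theorem tendsto_of_approx {E ι : Type*} [NormedAddCommGroup E] [NormedSpace ℂ E] {l : Filter ι}
    {φ : ι → E →L[ℂ] ℂ} {ψ : E →L[ℂ] ℂ} {C : ℝ} (hφ : ∀ i, ‖φ i‖ ≤ C) {x : E}
    (h : ∀ ε > 0, ∃ x', ‖x - x'‖ < ε ∧ Tendsto (fun i => φ i x') l (𝓝 (ψ x'))) :
    Tendsto (fun i => φ i x) l (𝓝 (ψ x)) := by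
  rw [Metric.tendsto_nhds]
  intro ε hε
  set M := |C| + ‖ψ‖ + 1 with hM
  have hM0 : 0 < M := by positivity
  obtain ⟨x', hx', ht⟩ := h (ε / (2 * M)) (by positivity)
  filter_upwards [Metric.tendsto_nhds.1 ht (ε / 2) (by positivity)] with i hi
  rw [dist_eq_norm] at hi ⊢
  have h1 : ‖φ i (x - x')‖ ≤ |C| * ‖x - x'‖ :=
    (φ i).le_of_opNorm_le ((hφ i).trans (le_abs_self C)) _
  have h2 : ‖ψ (x - x')‖ ≤ ‖ψ‖ * ‖x - x'‖ := ψ.le_opNorm _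
  have h3 : M * ‖x - x'‖ ≤ ε / 2 := by
    calc M * ‖x - x'‖ ≤ M * (ε / (2 * M)) := by gcongr
      _ = ε / 2 := by field_simp
  have h4 : φ i x - ψ x = φ i (x - x') + (φ i x' - ψ x') - ψ (x - x') := by
    simp only [map_sub]; ring
  rw [h4]
  have h5 := norm_sub_le (φ i (x - x') + (φ i x' - ψ x')) (ψ (x - x'))
  have h6 := norm_add_le (φ i (x - x')) (φ i x' - ψ x')
  have h7 : M * ‖x - x'‖ = |C| * ‖x - x'‖ + ‖ψ‖ * ‖x - x'‖ + ‖x - x'‖ := by rw [hM]; ring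
  have h8 := norm_nonneg (x - x')
  linarith

/-- A bounded net of functionals on `ℓ^p(X)` which converges on point masses converges. -/
theorem tendsto_of_tendsto_delta {X ι : Type*} (hp : p ≠ ∞) {l : Filter ι}
    {φ : ι → Ell p X →L[ℂ] ℂ} {ψ : Ell p X →L[ℂ] ℂ} {C : ℝ} (hφ : ∀ i, ‖φ i‖ ≤ C)
    (h : ∀ g, Tendsto (fun i => φ i (delta p g)) l (𝓝 (ψ (delta p g)))) (x : Ell p X) :
    Tendsto (fun i => φ i x) l (𝓝 (ψ x)) := by
  refine tendsto_of_approx hφ fun ε hε => ?_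
  obtain ⟨s, hs⟩ := (Metric.tendsto_nhds.1 (hasSum_delta hp x) ε hε).exists
  refine ⟨_, by rwa [dist_comm, dist_eq_norm] at hs, ?_⟩
  simp only [map_sum, map_smul]
  exact tendsto_finsetSum _ fun g _ => (h g).const_smul _

theorem norm_pairing_apply_le {G : Type*} (y : Ell p.conjExponent G) (T : Op p G) (x : Ell p G) :
    ‖pairing y (T x)‖ ≤ ‖T‖ * (‖y‖ * ‖x‖) := by
  refine (norm_pairing_le y (T x)).trans ?_
  calc ‖y‖ * ‖T x‖ ≤ ‖y‖ * (‖T‖ * ‖x‖) := by gcongr; exact T.le_opNorm x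
    _ = _ := by ring

/-- On bounded nets, convergence of matrix coefficients implies weak*-convergence. -/
theorem tendsto_weakStar {G ι : Type*} (hp₁ : 1 < p) (hp : p ≠ ∞) {l : Filter ι} {T : ι → Op p G}
    {S : Op p G} {C : ℝ} (hC : ∀ i, ‖T i‖ ≤ C)
    (h : ∀ g h, Tendsto (fun i => T i (delta p g) h) l (𝓝 (S (delta p g) h))) :
    Tendsto T l (@nhds _ (weakStar p G) S) := by
  -- Point masses span densely in `ℓ^p` as `p < ∞`, and in `ℓ^{p'}` as `p > 1`. This frees first
  -- `x`, then `y`; dominated convergence then handles the infinite sums of elementary tensors.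
  have h1 : ∀ (x : Ell p G) (k : G), Tendsto (fun i => T i x k) l (𝓝 (S x k)) := by
    intro x k
    refine tendsto_of_tendsto_delta (φ := fun i => (evalAt p k).comp (T i))
      (ψ := (evalAt p k).comp S) (C := ‖evalAt p (X := G) k‖ * C) hp (fun i => ?_)
      (fun g => h g k) x
    exact ((evalAt p k).opNorm_comp_le _).trans (by gcongr; exact hC i)
  have h2 : ∀ (y : Ell p.conjExponent G) (x : Ell p G),
      Tendsto (fun i => pairing y (T i x)) l (𝓝 (pairing y (S x))) := by
    intro y x
    refine tendsto_of_tendsto_delta (φ := fun i => (pairingL p G).flip (T i x))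
      (ψ := (pairingL p G).flip (S x)) (C := C * ‖x‖) (conjExponent_ne_top hp₁)
      (fun i => ?_) (fun g => ?_) y
    · have hC0 := (norm_nonneg _).trans (hC i)
      refine ContinuousLinearMap.opNorm_le_bound _ (by positivity) fun y => ?_
      refine (norm_pairing_apply_le y (T i) x).trans ?_
      calc ‖T i‖ * (‖y‖ * ‖x‖) ≤ C * (‖y‖ * ‖x‖) := by gcongr; exact hC i
        _ = _ := by ring
    · simp only [ContinuousLinearMap.flip_apply, pairingL_apply, pairing_delta_left]
      exact h1 x g
  simp only [nhds_iInf, tendsto_iInf, nhds_induced, tendsto_comap_iff]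
  intro y x hyx
  refine tendsto_tsum_of_dominated_convergence (hyx.mul_left C) (fun j => h2 (y j) (x j))
    (Eventually.of_forall fun i j => ?_)
  exact (norm_pairing_apply_le _ _ _).trans (by gcongr; exact hC i)

theorem continuous_weakStar_pairing {G : Type*} (y : Ell p.conjExponent G) (x : Ell p G) :
    Continuous[weakStar p G, _] fun T : Op p G => pairing y (T x) := by
  refine continuous_iff_le_induced.2 ?_
  -- The elementary tensor `y ⊗ x` is the sequence whose only non-zero term is the one at index `0`.
  have h0 : ∀ j ≠ 0, ‖(Pi.single 0 y : ℕ → Ell p.conjExponent G) j‖ *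
      ‖(fun _ => x : ℕ → Ell p G) j‖ = 0 := fun j hj => by simp [hj]
  refine iInf_le_of_le (Pi.single 0 y) (iInf_le_of_le (fun _ => x) (iInf_le_of_le
    (summable_of_ne_finset_zero (s := {0}) fun j hj => h0 j (by simpa using hj)) (le_of_eq ?_)))
  congr 1
  funext T
  rw [tsum_eq_single 0]
  · simp
  · intro j hj
    simp [hj, pairing]

theorem continuous_weakStar_apply {G : Type*} (x : Ell p G) (g : G) :
    Continuous[weakStar p G, _] fun T : Op p G => T x g := by
  simpa only [pairing_delta_left] using continuous_weakStar_pairing (delta p.conjExponent g) x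

/-- The weak*-topology is coarser than the norm topology. -/
theorem norm_topology_le_weakStar (G : Type*) :
    (inferInstance : TopologicalSpace (Op p G)) ≤ weakStar p G := by
  refine le_iInf fun y => le_iInf fun x => le_iInf fun hyx => continuous_iff_le_induced.1 ?_
  refine continuous_iff_continuousAt.2 fun S => ?_
  refine tendsto_tsum_of_dominated_convergence (hyx.mul_left (‖S‖ + 1)) (fun j => ?_) ?_
  · have : Continuous fun T : Op p G => pairingL p G (y j) (T (x j)) := by fun_prop
    exact this.tendsto S
  · filter_upwards [(continuous_norm.tendsto S).eventually_lt_const (lt_add_one ‖S‖)] with T hT j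
    exact (norm_pairing_apply_le _ _ _).trans (by gcongr)

theorem isClosed_of_isClosed_weakStar {G : Type*} {s : Set (Op p G)}
    (hs : IsClosed[weakStar p G] s) : IsClosed s :=
  hs.mono (norm_topology_le_weakStar G)

theorem isClosed_weakStar_eq {G : Type*} {f g : Op p G → ℂ} (hf : Continuous[weakStar p G, _] f)
    (hg : Continuous[weakStar p G, _] g) : IsClosed[weakStar p G] {T | f T = g T} :=
  @isClosed_eq _ _ _ (weakStar p G) _ _ _ hf hg

theorem isClosed_weakStar_mul_right_eq {G : Type*} (P : Op p G) :
    IsClosed[weakStar p G] {T : Op p G | T * P = T} := by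
  have : {T : Op p G | T * P = T} = ⋂ (x : Ell p G) (g : G), {T : Op p G | T (P x) g = T x g} := by
    ext T
    simp only [Set.mem_iInter]
    refine ⟨fun h x g => ?_,
      fun h => ContinuousLinearMap.ext fun x => lp.ext (funext fun g => h x g)⟩
    change (T * P) x g = T x g
    rw [show T * P = T from h]
  rw [this]
  exact @isClosed_iInter _ _ (weakStar p G) _ fun x => @isClosed_iInter _ _ (weakStar p G) _
    fun g => isClosed_weakStar_eq (continuous_weakStar_apply _ _) (continuous_weakStar_apply _ _)

/-- The coordinate `(S T x)(g)` applies the functional `evalAt p g ∘ S` to `T x`. Representing this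
functional by an element of `ℓ^{p'}` makes the coordinate weak*-continuous in `T`. -/
theorem isClosed_weakStar_mul_left_eq_zero {G : Type*} (hp₁ : 1 < p) (hp : p ≠ ∞) (S : Op p G) :
    IsClosed[weakStar p G] {T : Op p G | S * T = 0} := by
  choose y hy using fun g : G => exists_pairing_eq hp₁ hp ((evalAt p g).comp S)
  have : {T : Op p G | S * T = 0} =
      ⋂ (x : Ell p G) (g : G), {T : Op p G | pairing (y g) (T x) = 0} := by
    ext T
    simp only [Set.mem_iInter]
    refine ⟨fun h x g => ?_, fun h => ContinuousLinearMap.ext fun x => lp.ext (funext fun g => ?_)⟩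
    · change pairing (y g) (T x) = 0
      rw [← hy]
      change (S * T) x g = 0
      rw [show S * T = 0 from h]
      rfl
    · have := h x g
      change pairing (y g) (T x) = 0 at this
      rwa [← hy] at this
  rw [this]
  exact @isClosed_iInter _ _ (weakStar p G) _ fun x => @isClosed_iInter _ _ (weakStar p G) _
    fun g => isClosed_weakStar_eq (continuous_weakStar_pairing _ _)
      (@continuous_const _ _ (weakStar p G) _ _)

end WeakStar

/-! ### Regular representations and convolution kernels. -/

section Regular

variable {p : ℝ≥0∞} [Fact (1 ≤ p)] {G : Type*} [Group G]

theorem leftReg_apply (t : G) (x : Ell p G) (g : G) : leftReg p t x g = x (t⁻¹ * g) := rfl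

theorem leftReg_one : leftReg p (1 : G) = 1 := by
  ext x g
  simp [leftReg_apply]

theorem leftReg_mul (s t : G) : leftReg p (s * t) = leftReg p s * leftReg p t := by
  ext x g
  simp [leftReg_apply, mul_assoc]

theorem leftReg_delta (t g : G) : leftReg p t (delta p g) = delta p (t * g) := by
  ext h
  by_cases hh : h = t * g
  · simp [leftReg_apply, hh, delta_apply]
  · rw [leftReg_apply, delta_apply_of_ne hh, delta_apply_of_ne]
    rwa [Ne, inv_mul_eq_iff_eq_mul]

theorem rightReg_delta (t g : G) : rightReg p t (delta p g) = delta p (g * t⁻¹) := by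
  ext h
  by_cases hh : h = g * t⁻¹
  · simp [rightReg_apply, hh, delta_apply]
  · rw [rightReg_apply, delta_apply_of_ne hh, delta_apply_of_ne]
    rwa [Ne, ← eq_mul_inv_iff_mul_eq]

theorem norm_leftReg_le (t : G) : ‖leftReg p t‖ ≤ 1 :=
  by
  rw [leftReg, compOp]
  exact LinearMap.mkContinuous_norm_le _ zero_le_one _

theorem norm_rightReg_le (t : G) : ‖rightReg p t‖ ≤ 1 :=
  by
  rw [rightReg, compOp]
  exact LinearMap.mkContinuous_norm_le _ zero_le_one _

theorem leftReg_mem_CV (t : G) : leftReg p t ∈ CV p G := by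
  refine mem_CV_iff.2 fun s x => ?_
  ext g
  simp [leftReg_apply, rightReg_apply, mul_assoc]

/-- Since `δ_g` is a right translate of `δ_1`, the matrix of `T` depends only on `h g⁻¹`: `T` is
convolution by `T δ_1`. -/
theorem CV_apply_delta {T : Op p G} (hT : T ∈ CV p G) (g h : G) :
    T (delta p g) h = T (delta p 1) (h * g⁻¹) := by
  have := mem_CV_iff.1 hT g⁻¹ (delta p 1)
  rw [rightReg_delta, inv_inv, one_mul] at this
  rw [this, rightReg_apply]

theorem CV_ext (hp : p ≠ ∞) {S T : Op p G} (hS : S ∈ CV p G) (hT : T ∈ CV p G)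
    (h : S (delta p 1) = T (delta p 1)) : S = T :=
  clm_ext hp fun g => by
    ext k
    rw [CV_apply_delta hS, CV_apply_delta hT, h]

theorem isClosed_CV : IsClosed (CV p G : Set (Op p G)) := by
  have : (CV p G : Set (Op p G)) = ⋂ t : G, {T | rightReg p t * T = T * rightReg p t} := by
    ext T
    rw [SetLike.mem_coe, CV, Subalgebra.mem_centralizer_iff]
    simp
  rw [this]
  exact isClosed_iInter fun t => isClosed_eq (by fun_prop) (by fun_prop)

end Regular

/-! ### Finite conjugacy classes and coset coverings. -/

section ConjugacyClasses

variable {G : Type*} [Group G]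

/-- Orbit–stabilizer for conjugation: left cosets of the centralizer of `g` correspond to conjugates
of `g`. -/
theorem finiteIndex_centralizer_iff {g : G} :
    (Subgroup.centralizer {g}).FiniteIndex ↔ (conjugatesOf g).Finite := by
  have key : ∀ s t : G, s * g * s⁻¹ = t * g * t⁻¹ ↔ s⁻¹ * t ∈ Subgroup.centralizer {g} := by
    intro s t
    rw [Subgroup.mem_centralizer_singleton_iff]
    constructor
    · intro h
      have h1 : g = s⁻¹ * (t * g * t⁻¹) * s := by rw [← h]; group
      calc s⁻¹ * t * g = s⁻¹ * (t * g * t⁻¹) * s * (s⁻¹ * t) := by group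
        _ = g * (s⁻¹ * t) := by rw [← h1]
    · intro h
      have : t * g * t⁻¹ = s * (s⁻¹ * t * g) * t⁻¹ := by group
      rw [this, h]; group
  constructor
  · intro h
    have : Finite (G ⧸ Subgroup.centralizer {g}) := Subgroup.finite_quotient_of_finiteIndex
    refine (Set.finite_range fun q : G ⧸ Subgroup.centralizer {g} => q.out * g * q.out⁻¹).subset ?_
    intro b hb
    obtain ⟨c, rfl⟩ := isConj_iff.1 (show IsConj g b from hb)
    refine ⟨(c : G ⧸ _), ?_⟩
    rw [key, ← QuotientGroup.eq, QuotientGroup.out_eq']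
  · intro h
    have := h.to_subtype
    have : Finite (G ⧸ Subgroup.centralizer {g}) := by
      refine Finite.of_injective (β := conjugatesOf g) (fun q => ⟨q.out * g * q.out⁻¹,
        show IsConj g _ from isConj_iff.2 ⟨_, rfl⟩⟩) fun q r hqr => ?_
      have hqr := congrArg Subtype.val hqr
      rw [key, ← QuotientGroup.eq, QuotientGroup.out_eq',
        QuotientGroup.out_eq'] at hqr
      exact hqr
    exact Subgroup.finiteIndex_of_finite_quotient

open scoped Pointwise in
/-- In an ICC group, a finite set can be conjugated away from itself, up to the identity. -/
theorem IsICC.exists_conj_notMem (hG : IsICC G) (E : Finset G) :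
    ∃ t : G, ∀ g ∈ E, g ≠ 1 → t⁻¹ * g * t ∉ E := by
  classical
  by_contra! hcon
  let s : Finset (G × G) := (E ×ˢ E).filter fun z => z.2 ≠ 1 ∧ ∃ t, z.1 * t = t * z.2
  have hs : ∀ z : G × G, ∃ t : G, z ∈ s → z.1 * t = t * z.2 := by
    intro z
    by_cases hz : z ∈ s
    · obtain ⟨t, ht⟩ := (Finset.mem_filter.1 hz).2.2
      exact ⟨t, fun _ => ht⟩
    · exact ⟨1, fun h => absurd h hz⟩
  choose c hc using hs
  -- If every `t` failed, some non-trivial `g ∈ E` would have `t⁻¹ g t ∈ E`, placing `t` in the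
  -- coset attached to the pair `(g, t⁻¹ g t)`. There are only finitely many pairs, so by Neumann's
  -- lemma one of the centralizers has finite index.
  have hcover : ⋃ z ∈ s, c z • (Subgroup.centralizer {z.2} : Set G) = Set.univ := by
    refine Set.eq_univ_of_forall fun t => ?_
    obtain ⟨g, hg, hg1, hgt⟩ := hcon t
    have hz : (g, t⁻¹ * g * t) ∈ s := by
      refine Finset.mem_filter.2 ⟨Finset.mk_mem_product hg hgt, fun h => hg1 ?_, t, by group⟩
      have : g = t * (t⁻¹ * g * t) * t⁻¹ := by group
      rw [this, show t⁻¹ * g * t = 1 from h]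
      group
    refine Set.mem_iUnion₂.2 ⟨_, hz, ?_⟩
    rw [mem_leftCoset_iff, SetLike.mem_coe, Subgroup.mem_centralizer_singleton_iff]
    have h := hc _ hz
    dsimp only at h ⊢
    set u := c (g, t⁻¹ * g * t)
    have h' : u⁻¹ * g = t⁻¹ * g * t * u⁻¹ := by
      rw [eq_mul_inv_iff_mul_eq, mul_assoc, h]; group
    calc u⁻¹ * t * (t⁻¹ * g * t) = u⁻¹ * g * t := by group
      _ = _ := by rw [h']; group
  obtain ⟨z, hz, hfin⟩ := Subgroup.exists_finiteIndex_of_leftCoset_cover hcover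
  exact hG z.2 (Finset.mem_filter.1 hz).2.1 (finiteIndex_centralizer_iff.1 hfin)

end ConjugacyClasses

/-! ### Weak*-simplicity for ICC groups. -/

section ICC

open Filter

variable {p : ℝ≥0∞} [Fact (1 ≤ p)] {G : Type*} [Group G]

theorem tendsto_cofinite_zero {X : Type*} (hp : p ≠ ∞) (x : Ell p X) :
    Tendsto (fun g => x g) cofinite (𝓝 0) := by
  have := (hasSum_delta hp x).summable.tendsto_cofinite_zero
  rw [tendsto_zero_iff_norm_tendsto_zero] at this ⊢
  simpa [norm_smul, norm_delta] using this

/-- For an ICC group, conjugating a convolution operator by suitable translations converges to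
its trace part. -/
theorem IsICC.exists_tendsto (hG : IsICC G) (hp₁ : 1 < p) (hp : p ≠ ∞) {T : Op p G}
    (hT : T ∈ CV p G) : ∃ t : Finset G → G,
      Tendsto (fun E => leftReg p (t E) * T * leftReg p (t E)⁻¹) atTop
        (@nhds _ (weakStar p G) (T (delta p 1) 1 • (1 : Op p G))) := by
  classical
  choose t ht using hG.exists_conj_notMem
  refine ⟨t, tendsto_weakStar hp₁ hp (C := ‖T‖) (fun E => ?_) fun g h => ?_⟩
  · calc _ ≤ ‖leftReg p (t E)‖ * ‖T‖ * ‖leftReg p (t E)⁻¹‖ :=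
        (norm_mul_le _ _).trans (by gcongr; exact norm_mul_le _ _)
      _ ≤ 1 * ‖T‖ * 1 := by gcongr <;> exact norm_leftReg_le _
      _ = ‖T‖ := by ring
  · have h1 : ∀ E, (leftReg p (t E) * T * leftReg p (t E)⁻¹) (delta p g) h =
        T (delta p 1) ((t E)⁻¹ * (h * g⁻¹) * t E) := by
      intro E
      change leftReg p (t E) (T (leftReg p (t E)⁻¹ (delta p g))) h = _
      rw [leftReg_delta, leftReg_apply, CV_apply_delta hT]
      group
    simp only [h1]
    change Tendsto _ _ (𝓝 (T (delta p 1) 1 * delta p g h))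
    by_cases hgh : h = g
    · subst hgh
      simp [delta_apply_self]
    · rw [delta_apply_of_ne hgh, mul_zero]
      refine (tendsto_cofinite_zero hp (T (delta p 1))).comp ?_
      intro F hF
      rw [mem_map]
      -- Once `E` contains both `h g⁻¹` and the finite complement of `F`, the choice of `t E` sends
      -- the conjugate of `h g⁻¹` outside `E`, hence into `F`.
      filter_upwards [eventually_ge_atTop (hF.toFinset ∪ {h * g⁻¹})] with E hE
      by_contra hmem
      refine ht E (h * g⁻¹) (hE (by simp)) (by rwa [Ne, mul_inv_eq_one]) (hE ?_)
      exact Finset.mem_union_left _ ((Set.Finite.mem_toFinset hF).2 hmem)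

theorem leftReg_mem {A : Subalgebra ℂ (Op p G)} (hPM : PM p G ⊆ (A : Set (Op p G))) (t : G) :
    leftReg p t ∈ A :=
  hPM (@subset_closure _ (weakStar p G) _ _ (Submodule.subset_span ⟨t, rfl⟩))

theorem IsICC.isWeakStarSimple (hG : IsICC G) (hp₁ : 1 < p) (hp : p ≠ ∞)
    {A : Subalgebra ℂ (Op p G)} (hPM : PM p G ⊆ (A : Set (Op p G))) (hCV : A ≤ CV p G) :
    IsWeakStarSimple A := by
  intro I hI
  by_cases hbot : ∀ T ∈ I, T = 0
  · left
    refine TwoSidedIdeal.ext fun T => ⟨fun hT => ?_, fun hT => ?_⟩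
    · rw [hbot T hT]
      exact TwoSidedIdeal.zero_mem _
    · rw [TwoSidedIdeal.mem_bot] at hT
      rw [hT]
      exact TwoSidedIdeal.zero_mem _
  right
  push Not at hbot
  obtain ⟨T, hTI, hT0⟩ := hbot
  obtain ⟨g, hg⟩ : ∃ g : G, (T : Op p G) (delta p 1) g ≠ 0 := by
    by_contra! h
    refine hT0 (Subtype.ext (CV_ext hp (hCV T.2) (zero_mem _) ?_))
    ext g
    exact h g
  let lam : G → A := fun t => ⟨leftReg p t, leftReg_mem hPM t⟩
  -- Translation by `g⁻¹` moves the non-zero coefficient at `g` to the identity, where conjugation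
  -- cannot displace it.
  set S : A := lam g⁻¹ * T with hS
  have hSI : S ∈ I := I.mul_mem_left _ _ hTI
  set c : ℂ := (S : Op p G) (delta p 1) 1
  have hc : c ≠ 0 := by
    change leftReg p g⁻¹ ((T : Op p G) (delta p 1)) 1 ≠ 0
    rwa [leftReg_apply, inv_inv, mul_one]
  obtain ⟨t, ht⟩ := hG.exists_tendsto hp₁ hp (hCV S.2)
  have hmem := @IsClosed.mem_of_tendsto (Op p G) (weakStar p G) _ _ _ _ _ _ hI ht
    (Eventually.of_forall fun E => ⟨lam (t E) * S * lam (t E)⁻¹,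
      I.mul_mem_right _ _ (I.mul_mem_left _ _ hSI), rfl⟩)
  obtain ⟨R, hR, hRc⟩ := hmem
  have h1 : (1 : A) ∈ I := by
    have : (1 : A) = algebraMap ℂ A c⁻¹ * R := by
      refine Subtype.ext ?_
      change (1 : Op p G) = algebraMap ℂ (Op p G) c⁻¹ * (R : Op p G)
      rw [show (R : Op p G) = c • 1 from hRc, Algebra.algebraMap_eq_smul_one, smul_mul_smul,
        inv_mul_cancel₀ hc, one_smul, one_mul]
    rw [this]
    exact I.mul_mem_left _ _ hR
  exact (TwoSidedIdeal.one_mem_iff _).1 h1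

end ICC

/-! ### Zero divisors in `ℓ^1(ℤ)` from Fourier series. -/

section Fourier

open MeasureTheory AddCircle

/-- Integration by parts bounds the `n`-th coefficient of `f` by a constant times that of `f'`
divided by `|n|`. Both factors are square summable, the first by Parseval, so their product is
summable. -/
theorem summable_fourierCoeffOn {a b : ℝ} (hab : a < b) {f f' : ℝ → ℂ}
    (hf : ∀ x, HasDerivAt f (f' x) x) (hf' : Continuous f') (hfab : f b = f a) :
    Summable fun n => ‖fourierCoeffOn hab f n‖ := by
  have h1 : Summable fun n : ℤ => ‖fourierCoeffOn hab f' n‖ ^ 2 := by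
    refine (hasSum_sq_fourierCoeffOn hab ?_).summable
    obtain ⟨C, hC⟩ := isCompact_Icc.exists_bound_of_continuousOn (s := Set.Icc a b) hf'.continuousOn
    exact MemLp.of_bound hf'.aestronglyMeasurable C
      (ae_restrict_of_forall_mem measurableSet_Ioc fun x hx => hC x (Set.Ioc_subset_Icc_self hx))
  have h2 : Summable fun n : ℤ => 1 / (n : ℝ) ^ 2 := Real.summable_one_div_int_pow.2 one_lt_two
  refine Summable.of_norm_bounded_eventually
    (g := fun n : ℤ => (b - a) * (‖fourierCoeffOn hab f' n‖ ^ 2 + 1 / (n : ℝ) ^ 2))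
    ((h1.add h2).mul_left _) ?_
  refine (Set.finite_singleton (0 : ℤ)).subset fun n hn => ?_
  by_contra hn0
  refine hn ?_
  change n ≠ 0 at hn0
  change ‖‖fourierCoeffOn hab f n‖‖ ≤
    (b - a) * (‖fourierCoeffOn hab f' n‖ ^ 2 + 1 / (n : ℝ) ^ 2)
  rw [fourierCoeffOn_of_hasDerivAt hab hn0 (fun x _ => hf x) (hf'.intervalIntegrable _ _), hfab,
    sub_self, mul_zero, zero_sub, norm_norm, norm_mul, norm_neg, norm_mul]
  have e1 : ‖((b : ℂ) - a)‖ = b - a := by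
    rw [← Complex.ofReal_sub, Complex.norm_real, Real.norm_of_nonneg (by linarith)]
  have e2 : ‖1 / (-2 * (Real.pi : ℂ) * Complex.I * n)‖ ≤ 1 / |(n : ℝ)| := by
    have : (0 : ℝ) < |(n : ℝ)| := by positivity
    simp only [norm_div, norm_mul, norm_neg, Complex.norm_I, Complex.norm_intCast, norm_one,
      Complex.norm_real, Complex.norm_ofNat, Real.norm_eq_abs, abs_of_pos Real.pi_pos]
    gcongr
    nlinarith [Real.pi_gt_three]
  rw [e1]
  set u := ‖fourierCoeffOn hab f' n‖
  set v := 1 / |(n : ℝ)| with hv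
  have e3 : 1 / (n : ℝ) ^ 2 = v ^ 2 := by rw [hv, div_pow, sq_abs, one_pow]
  rw [e3]
  have hu : 0 ≤ u := norm_nonneg _
  have hba : 0 < b - a := by linarith
  calc _ ≤ v * ((b - a) * u) := by gcongr
    _ = (b - a) * (u * v) := by ring
    _ ≤ _ := by gcongr; nlinarith [sq_nonneg (u - v), sq_nonneg u, sq_nonneg v]

/-- Squaring removes the corner of the positive part, giving the continuous derivative needed for
absolutely summable Fourier coefficients. -/
theorem hasDerivAt_max_zero_sq (x : ℝ) :
    HasDerivAt (fun y : ℝ => (max 0 y) ^ 2) (2 * max 0 x) x := by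
  rcases lt_trichotomy x 0 with h | h | h
  · rw [max_eq_left h.le, mul_zero]
    refine (hasDerivAt_const x (0 : ℝ)).congr_of_eventuallyEq ?_
    filter_upwards [gt_mem_nhds h] with y hy
    rw [max_eq_left hy.le]; simp
  · subst h
    rw [max_self, mul_zero, hasDerivAt_iff_isLittleO_nhds_zero]
    simp only [zero_add, max_self, smul_zero, sub_zero]
    refine Asymptotics.IsBigO.trans_isLittleO (g := fun h : ℝ => h ^ 2) ?_ ?_
    · refine Asymptotics.isBigO_of_le _ fun y => ?_
      rcases le_total y 0 with hy | hy
      · simp [max_eq_left hy, sq_nonneg]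
      · simp [max_eq_right hy]
    · simpa using Asymptotics.isLittleO_pow_id (𝕜 := ℝ) one_lt_two
  · rw [max_eq_right h.le]
    refine (((hasDerivAt_id x).pow 2).congr_deriv (by simp)).congr_of_eventuallyEq ?_
    filter_upwards [lt_mem_nhds h] with y hy
    simp [max_eq_right hy.le]

/-- The square of the positive part of `σ cos (2 π x)`, as a function on the circle. -/
def cosBump (σ : ℝ) : C(AddCircle (1 : ℝ), ℂ) where
  toFun x := (((max 0 (σ * (fourier 1 x).re)) ^ 2 : ℝ) : ℂ)
  continuous_toFun := by fun_prop

theorem cosBump_coe (σ x : ℝ) :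
    cosBump σ (x : AddCircle (1 : ℝ)) =
      (((max 0 (σ * Real.cos (2 * Real.pi * x))) ^ 2 : ℝ) : ℂ) := by
  have : (fourier 1 (x : AddCircle (1 : ℝ))).re = Real.cos (2 * Real.pi * x) := by
    rw [fourier_coe_apply, ← Complex.exp_ofReal_mul_I_re]
    congr 2
    push_cast
    ring
  rw [← this]
  rfl

theorem summable_fourierCoeff_cosBump (σ : ℝ) : Summable fun n => ‖fourierCoeff (cosBump σ) n‖ := by
  -- Passing to the interval `(0, 1]` turns the coefficients on the circle into those covered by the
  -- differentiability criterion.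
  have hlift : liftIoc 1 0 (fun x : ℝ => cosBump σ (x : AddCircle (1 : ℝ))) = cosBump σ := by
    funext x
    obtain ⟨y, rfl⟩ := (equivIoc (1 : ℝ) 0).symm.surjective x
    exact liftIoc_coe_apply y.2
  rw [← hlift]
  simp only [fourierCoeff_liftIoc_eq, cosBump_coe]
  have hd : ∀ x : ℝ, HasDerivAt
      (fun x : ℝ => (((max 0 (σ * Real.cos (2 * Real.pi * x))) ^ 2 : ℝ) : ℂ))
      ((2 * max 0 (σ * Real.cos (2 * Real.pi * x)) *
        (σ * (-Real.sin (2 * Real.pi * x) * (2 * Real.pi * 1))) : ℝ) : ℂ) x := by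
    intro x
    refine HasDerivAt.ofReal_comp ?_
    exact (hasDerivAt_max_zero_sq _).comp x
      (((hasDerivAt_id x).const_mul (2 * Real.pi)).cos.const_mul σ)
  exact summable_fourierCoeffOn _ hd (by fun_prop) (by simp)

/-- The two bumps live on opposite half-circles, according to the sign of the cosine. -/
theorem cosBump_mul_neg (x : AddCircle (1 : ℝ)) : cosBump 1 x * cosBump (-1) x = 0 := by
  simp only [cosBump, ContinuousMap.coe_mk]
  rw [← Complex.ofReal_mul, Complex.ofReal_eq_zero]
  rcases le_total 0 ((fourier 1 x).re) with h | h
  · rw [neg_one_mul, max_eq_left (neg_nonpos.2 h)]; simp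
  · rw [one_mul, max_eq_left h]; simp

/-- The sum is the `m`-th Fourier coefficient of `F H`. Only the series of `F` is expanded, so
summability is needed for `F` alone and the bound `‖H‖` allows interchanging sum and integral. -/
theorem tsum_fourierCoeff_mul_eq_zero {F H : C(AddCircle (1 : ℝ), ℂ)} (hFH : ∀ x, F x * H x = 0)
    (hF : Summable fun n => ‖fourierCoeff F n‖) (m : ℤ) :
    ∑' k, fourierCoeff F k * fourierCoeff H (m - k) = 0 := by
  have h := hasSum_integral_of_summable_integral_norm (μ := haarAddCircle (T := (1 : ℝ)))
    (F := fun (k : ℤ) (x : AddCircle (1 : ℝ)) =>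
      fourierCoeff F k * (fourier (-(m - k)) x * H x)) (fun k => ?_) ?_
  · have h1 : ∀ x, ∑' k, fourierCoeff F k * (fourier (-(m - k)) x * H x) = 0 := by
      intro x
      have hs := (has_pointwise_sum_fourier_series_of_summable hF.of_norm x).mul_right
        (fourier (-m) x * H x)
      refine (hs.congr_fun fun k => ?_).tsum_eq.trans ?_
      · rw [smul_eq_mul, neg_sub, sub_eq_add_neg, fourier_add]
        ring
      · rw [mul_left_comm, hFH, mul_zero]
    simp only [h1, integral_zero, integral_const_mul] at h
    exact h.tsum_eq
  · exact Continuous.integrable_of_hasCompactSupport (by fun_prop)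
      (HasCompactSupport.of_compactSpace _)
  · refine Summable.of_nonneg_of_le (fun k => integral_nonneg fun x => norm_nonneg _) (fun k => ?_)
      (hF.mul_right ‖H‖)
    refine (integral_mono_of_nonneg (Filter.Eventually.of_forall fun _ => norm_nonneg _)
      (integrable_const (‖fourierCoeff F k‖ * ‖H‖)) (Filter.Eventually.of_forall fun x => ?_)).trans
      (by simp)
    beta_reduce
    rw [norm_mul, norm_mul, fourier_apply, Circle.norm_coe, one_mul]
    gcongr
    exact H.norm_coe_le_norm x

/-- There are zero divisors in `ℓ^1(ℤ)`, one of which does not vanish at the trivial character. -/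
theorem exists_summable_convolution_eq_zero : ∃ f h : ℤ → ℂ,
    (Summable fun k => ‖f k‖) ∧ (Summable fun k => ‖h k‖) ∧ ∑' k, f k = 1 ∧ (∃ k, h k ≠ 0) ∧
      ∀ m, ∑' k, f k * h (m - k) = 0 := by
  refine ⟨fourierCoeff (cosBump 1), fourierCoeff (cosBump (-1)),
    summable_fourierCoeff_cosBump _, summable_fourierCoeff_cosBump _, ?_, ?_,
    tsum_fourierCoeff_mul_eq_zero cosBump_mul_neg (summable_fourierCoeff_cosBump _)⟩
  -- The series is evaluated where the bump equals `1`: at `0` for `σ = 1`, and at `1/2` for `σ =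
  -- -1` below.
  · have := (has_pointwise_sum_fourier_series_of_summable
      (summable_fourierCoeff_cosBump 1).of_norm ((0 : ℝ) : AddCircle (1 : ℝ))).tsum_eq
    rw [cosBump_coe] at this
    simpa using this
  · by_contra! h0
    have := (has_pointwise_sum_fourier_series_of_summable
      (summable_fourierCoeff_cosBump (-1)).of_norm ((1 / 2 : ℝ) : AddCircle (1 : ℝ))).tsum_eq
    rw [cosBump_coe, show 2 * Real.pi * (1 / 2) = Real.pi by ring] at this
    simp [h0] at this

end Fourier

/-! ### A commutation criterion and absolutely summable combinations of translations. -/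

section BiRegular

variable {p : ℝ≥0∞} [Fact (1 ≤ p)] {G : Type*} [Group G]

theorem rightReg_commute {T : Op p G} (hT : T ∈ CV p G) (t : G) :
    T * rightReg p t = rightReg p t * T :=
  ((Subalgebra.mem_centralizer_iff ℂ).1 hT _ ⟨t, rfl⟩).symm

/-- The convolution operators `w` for which some `r` in the commutant of `CV_p(G)` has
`r δ_1 = w δ_1`. -/
def biRegular (p : ℝ≥0∞) [Fact (1 ≤ p)] (G : Type*) [Group G] : Subalgebra ℂ (Op p G) where
  carrier := {w | w ∈ CV p G ∧
    ∃ r : Op p G, (∀ T ∈ CV p G, T * r = r * T) ∧ r (delta p 1) = w (delta p 1)}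
  mul_mem' := by
    rintro w₁ w₂ ⟨h₁, r₁, hr₁, e₁⟩ ⟨h₂, r₂, hr₂, e₂⟩
    -- The order is reversed: `r₂ r₁ δ_1 = r₂ w₁ δ_1 = w₁ r₂ δ_1 = w₁ w₂ δ_1`.
    refine ⟨mul_mem h₁ h₂, r₂ * r₁, fun T hT => ?_, ?_⟩
    · rw [← mul_assoc, hr₂ T hT, mul_assoc, hr₁ T hT, mul_assoc]
    · change r₂ (r₁ _) = w₁ (w₂ _)
      rw [e₁, ← e₂]
      exact (congrArg (fun S : Op p G => S (delta p 1)) (hr₂ w₁ h₁)).symm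
  add_mem' := by
    rintro w₁ w₂ ⟨h₁, r₁, hr₁, e₁⟩ ⟨h₂, r₂, hr₂, e₂⟩
    refine ⟨add_mem h₁ h₂, r₁ + r₂, fun T hT => ?_, ?_⟩
    · rw [mul_add, add_mul, hr₁ T hT, hr₂ T hT]
    · change r₁ _ + r₂ _ = w₁ _ + w₂ _
      rw [e₁, e₂]
  algebraMap_mem' c := ⟨algebraMap_mem _ c, algebraMap ℂ _ c,
    fun T _ => (Algebra.commutes c T).symm, rfl⟩

/-- An element of `biRegular p G` which commutes with the left translations commutes with all
convolution operators. -/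
theorem commute_of_mem_biRegular (hp : p ≠ ∞) {w : Op p G} (hw : w ∈ biRegular p G)
    (hlam : ∀ g : G, leftReg p g * w = w * leftReg p g) {T : Op p G} (hT : T ∈ CV p G) :
    T * w = w * T := by
  obtain ⟨-, r, hr, e⟩ := hw
  have : w = r := clm_ext hp fun g => by
    have h1 : delta p g = leftReg p g (delta p 1) := by rw [leftReg_delta, mul_one]
    calc w (delta p g) = (w * leftReg p g) (delta p 1) := by rw [h1]; rfl
      _ = leftReg p g (w (delta p 1)) := by rw [← hlam]; rfl
      _ = (leftReg p g * r) (delta p 1) := by rw [← e]; rfl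
      _ = r (delta p g) := by rw [hr _ (leftReg_mem_CV g), h1]; rfl
  rw [this]
  exact hr T hT

theorem leftReg_mem_biRegular (t : G) : leftReg p t ∈ biRegular p G :=
  ⟨leftReg_mem_CV t, rightReg p t⁻¹, fun _ hT => rightReg_commute hT _, by
    rw [leftReg_delta, rightReg_delta, inv_inv, one_mul, mul_one]⟩

/-- The operator `∑ f(k) λ_p(t_k)`. -/
def leftSum (p : ℝ≥0∞) [Fact (1 ≤ p)] {ι G : Type*} [Group G] (f : ι → ℂ) (t : ι → G) : Op p G :=
  ∑' k, f k • leftReg p (t k)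

variable {ι κ : Type*}

theorem summable_norm_smul_leftReg {f : ι → ℂ} (hf : Summable fun k => ‖f k‖) (t : ι → G) :
    Summable fun k => ‖f k • leftReg p (t k)‖ :=
  hf.of_nonneg_of_le (fun _ => norm_nonneg _) fun k => by
    rw [norm_smul]
    exact mul_le_of_le_one_right (norm_nonneg _) (norm_leftReg_le _)

theorem hasSum_leftSum {f : ι → ℂ} (hf : Summable fun k => ‖f k‖) (t : ι → G) :
    HasSum (fun k => f k • leftReg p (t k)) (leftSum p f t) :=
  (summable_norm_smul_leftReg hf t).of_norm.hasSum

theorem leftSum_mem {B : Subalgebra ℂ (Op p G)} (hB : IsClosed (B : Set (Op p G))) {f : ι → ℂ}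
    (hf : Summable fun k => ‖f k‖) {t : ι → G} (ht : ∀ k, leftReg p (t k) ∈ B) :
    leftSum p f t ∈ B :=
  hB.mem_of_tendsto (hasSum_leftSum hf t)
    (Filter.Eventually.of_forall fun _ => sum_mem fun k _ => B.smul_mem (ht k) _)

theorem leftSum_mem_CV {f : ι → ℂ} (hf : Summable fun k => ‖f k‖) (t : ι → G) :
    leftSum p f t ∈ CV p G :=
  leftSum_mem isClosed_CV hf fun _ => leftReg_mem_CV _

/-- The counterpart in the commutant is `∑ f(k) ρ(t_k⁻¹)`, because `ρ(t⁻¹) δ_1 = δ_t = λ(t) δ_1`. -/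
theorem leftSum_mem_biRegular {f : ι → ℂ} (hf : Summable fun k => ‖f k‖) (t : ι → G) :
    leftSum p f t ∈ biRegular p G := by
  have hs : HasSum (fun k => f k • rightReg p (t k)⁻¹) (∑' k, f k • rightReg p (t k)⁻¹) := by
    refine (Summable.of_norm (hf.of_nonneg_of_le (fun _ => norm_nonneg _) fun k => ?_)).hasSum
    rw [norm_smul]
    exact mul_le_of_le_one_right (norm_nonneg _) (norm_rightReg_le _)
  refine ⟨leftSum_mem_CV hf t, ∑' k, f k • rightReg p (t k)⁻¹, fun T hT => ?_, ?_⟩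
  · refine (hs.mul_left T).unique ?_
    simp only [mul_smul_comm, rightReg_commute hT, ← smul_mul_assoc]
    exact hs.mul_right T
  · refine (hs.mapL (ContinuousLinearMap.apply ℂ (Ell p G) (delta p (1 : G)))).unique ?_
    have h := (hasSum_leftSum hf t).mapL (ContinuousLinearMap.apply ℂ (Ell p G) (delta p (1 : G)))
    refine h.congr_fun fun k => ?_
    simp [leftReg_delta, rightReg_delta]

theorem leftReg_mul_leftSum {f : ι → ℂ} (hf : Summable fun k => ‖f k‖) (t : ι → G) (g : G) :
    leftReg p g * leftSum p f t = leftSum p f (fun k => g * t k * g⁻¹) * leftReg p g := by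
  refine ((hasSum_leftSum hf t).mul_left _).unique ?_
  refine ((hasSum_leftSum hf fun k => g * t k * g⁻¹).mul_right (leftReg p g)).congr_fun fun k => ?_
  rw [mul_smul_comm, smul_mul_assoc, ← leftReg_mul, ← leftReg_mul, inv_mul_cancel_right]

theorem leftSum_mul {f : ι → ℂ} {h : κ → ℂ} (hf : Summable fun k => ‖f k‖)
    (hh : Summable fun k => ‖h k‖) (t : ι → G) (s : κ → G) :
    leftSum p f t * leftSum p h s =
      leftSum p (fun z : ι × κ => f z.1 * h z.2) fun z => t z.1 * s z.2 := by
  rw [leftSum, leftSum, tsum_mul_tsum_of_summable_norm (summable_norm_smul_leftReg hf t)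
    (summable_norm_smul_leftReg hh s)]
  exact tsum_congr fun z => by rw [smul_mul_smul_comm, leftReg_mul]

theorem leftSum_apply_delta {f : ι → ℂ} (hf : Summable fun k => ‖f k‖) (t : ι → G) (g : G) :
    leftSum p f t (delta p 1) g = ∑' k, (t ⁻¹' {g}).indicator f k := by
  have h := ((hasSum_leftSum (p := p) hf t).mapL
    (ContinuousLinearMap.apply ℂ (Ell p G) (delta p (1 : G)))).mapL (evalAt p g)
  refine (h.tsum_eq.symm.trans (tsum_congr fun k => ?_))
  change f k * leftReg p (t k) (delta p 1) g = _
  rw [leftReg_delta, mul_one]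
  by_cases hk : t k = g
  · simp [hk, delta_apply_self]
  · rw [delta_apply_of_ne (Ne.symm hk), Set.indicator_of_notMem (by simpa using hk), mul_zero]

/-- As `t` need not be injective, the coefficient of the operator at `g` is the sum of `f` over the
fibre of `t` above `g`. Adding up all fibres recovers the total sum. -/
theorem tsum_eq_zero_of_leftSum_eq_zero {f : ι → ℂ} (hf : Summable fun k => ‖f k‖) {t : ι → G}
    (h : leftSum p f t = 0) : ∑' k, f k = 0 := by
  have h1 : ∀ g : G, ∑' k : {k // t k = g}, f k = 0 := fun g => by
    have := leftSum_apply_delta (p := p) hf t g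
    rw [h] at this
    exact (tsum_subtype (t ⁻¹' {g}) f).trans this.symm
  rw [← (Equiv.sigmaFiberEquiv t).tsum_eq, Summable.tsum_sigma]
  · exact (tsum_congr fun g => h1 g).trans tsum_zero
  · exact (Equiv.sigmaFiberEquiv t).summable_iff.2 hf.of_norm

theorem leftSum_zpow_apply_delta {f : ℤ → ℂ} (hf : Summable fun k => ‖f k‖) {c : G}
    (hc : Function.Injective fun k : ℤ => c ^ k) (m : ℤ) :
    leftSum p f (fun k => c ^ k) (delta p 1) (c ^ m) = f m := by
  rw [leftSum_apply_delta hf, tsum_eq_single m]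
  · simp
  · intro k hk
    refine Set.indicator_of_notMem (fun h => hk (hc ?_)) _
    exact h

theorem leftSum_zpow_mul_eq_zero {f h : ℤ → ℂ} (hf : Summable fun k => ‖f k‖)
    (hh : Summable fun k => ‖h k‖) (hfh : ∀ m, ∑' k, f k * h (m - k) = 0) (c : G) :
    leftSum p f (fun k => c ^ k) * leftSum p h (fun k => c ^ k) = 0 := by
  have hs := summable_norm_smul_leftReg (p := p) (hf.mul_norm hh)
    (fun z : ℤ × ℤ => c ^ z.1 * c ^ z.2)
  let e : ℤ × ℤ ≃ ℤ × ℤ :=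
    { toFun := fun z => (z.2, z.1 - z.2)
      invFun := fun z => (z.1 + z.2, z.1)
      left_inv := fun z => by simp
      right_inv := fun z => by simp }
  -- Reindexing by `(m, k) ↦ (k, m - k)` gathers the terms with the same power `c ^ m`, whose total
  -- coefficient is the convolution at `m`.
  rw [leftSum_mul hf hh, leftSum, ← e.tsum_eq, Summable.tsum_prod]
  swap
  · exact e.summable_iff.2 hs.of_norm
  refine (tsum_congr fun m => ?_).trans tsum_zero
  have : ∀ k, f (e (m, k)).1 * h (e (m, k)).2 = f k * h (m - k) := fun k => rfl
  simp only [this, ← zpow_add]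
  have hs' : Summable fun k => f k * h (m - k) :=
    ((e.summable_iff.2 (hf.mul_norm hh)).prod_factor m).of_norm
  have h2 : ∀ k, (e (m, k)).1 + (e (m, k)).2 = m := fun k => by simp [e]
  simp only [h2]
  rw [hs'.tsum_smul_const, hfh, zero_smul]

end BiRegular

/-! ### The ideal attached to a finite normal subgroup. -/

section Average

variable {p : ℝ≥0∞} [Fact (1 ≤ p)] {G : Type*} [Group G]

theorem avg_eq (N : Subgroup G) [Fintype N] :
    avg p N = (Nat.card N : ℂ)⁻¹ • ∑ t : N, leftReg p (t : G) := by
  rw [avg, finsum_eq_sum_of_fintype]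

theorem avg_mem (N : Subgroup G) [Finite N] {B : Subalgebra ℂ (Op p G)}
    (hB : ∀ t : G, leftReg p t ∈ B) : avg p N ∈ B := by
  have := Fintype.ofFinite N
  rw [avg_eq]
  exact B.smul_mem (sum_mem fun t _ => hB _) _

theorem leftReg_mul_avg (N : Subgroup G) [Finite N] (s : N) :
    leftReg p (s : G) * avg p N = avg p N := by
  have := Fintype.ofFinite N
  rw [avg_eq, mul_smul_comm, Finset.mul_sum]
  congr 1
  refine (Finset.sum_congr rfl fun t _ => (leftReg_mul _ _).symm).trans ?_
  exact Equiv.sum_comp (Equiv.mulLeft s) fun t : N => leftReg p (t : G)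

theorem avg_mul_avg (N : Subgroup G) [Finite N] : avg p N * avg p N = avg p N := by
  have := Fintype.ofFinite N
  conv_lhs => rw [avg_eq]
  rw [← avg_eq, avg_eq, smul_mul_assoc, Finset.sum_mul, ← avg_eq]
  simp only [leftReg_mul_avg]
  rw [Finset.sum_const, Finset.card_univ, ← Nat.card_eq_fintype_card, ← Nat.cast_smul_eq_nsmul ℂ,
    inv_smul_smul₀]
  exact Nat.cast_ne_zero.2 Nat.card_pos.ne'

theorem leftReg_commute_avg (N : Subgroup G) [Finite N] [N.Normal] (g : G) :
    leftReg p g * avg p N = avg p N * leftReg p g := by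
  have := Fintype.ofFinite N
  rw [avg_eq, mul_smul_comm, smul_mul_assoc, Finset.mul_sum, Finset.sum_mul]
  congr 1
  rw [← (MulAut.conjNormal g : MulAut N).toEquiv.sum_comp
    fun t : N => leftReg p (t : G) * leftReg p g]
  refine Finset.sum_congr rfl fun t _ => ?_
  rw [← leftReg_mul, ← leftReg_mul]
  simp [MulAut.conjNormal_apply]

theorem avg_apply_delta (N : Subgroup G) [Finite N] (s : N) :
    avg p N (delta p 1) (s : G) = (Nat.card N : ℂ)⁻¹ := by
  have := Fintype.ofFinite N
  have h : ∀ x : Ell p G, avg p N x (s : G) =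
      (Nat.card N : ℂ)⁻¹ * ∑ t : N, leftReg p (t : G) x s := fun x => by
    have : avg p N x = (Nat.card N : ℂ)⁻¹ • ∑ t : N, leftReg p (t : G) x := by
      rw [avg_eq]; simp
    rw [this]
    have h2 := map_smul (evalAt p (s : G)) (Nat.card N : ℂ)⁻¹ (∑ t : N, leftReg p (t : G) x)
    rw [map_sum] at h2
    exact h2
  rw [h, Finset.sum_eq_single s]
  · rw [leftReg_delta, mul_one, delta_apply_self, mul_one]
  · intro t _ hts
    rw [leftReg_delta, mul_one, delta_apply_of_ne fun hh => hts (Subtype.ext hh.symm)]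
  · simp

theorem avg_commute (hp : p ≠ ∞) (N : Subgroup G) [Finite N] [N.Normal] {T : Op p G}
    (hT : T ∈ CV p G) : T * avg p N = avg p N * T :=
  commute_of_mem_biRegular hp (avg_mem N leftReg_mem_biRegular) (leftReg_commute_avg N) hT

/-- The coefficients of the average equal `1/|N|` at every point of `N`. The one at the identity
shows `P ≠ 0`; the one at a non-trivial element shows `P ≠ 1`. -/
theorem exists_ideal_of_finite_normal (hp : p ≠ ∞) {A : Subalgebra ℂ (Op p G)}
    (hA : IsClosed[weakStar p G] (A : Set (Op p G)))
    (hPM : PM p G ⊆ (A : Set (Op p G))) (hCV : A ≤ CV p G) (N : Subgroup G) [Finite N] [N.Normal]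
    (hN : N ≠ ⊥) :
    ∃ P : A, (P : Op p G) = avg p N ∧ P * P = P ∧ (∀ T : A, P * T = T * P) ∧
      ∃ I : TwoSidedIdeal A, (∀ T : A, T ∈ I ↔ ∃ S : A, T = S * P) ∧
        IsWeakStarClosedIdeal I ∧ I ≠ ⊥ ∧ I ≠ ⊤ := by
  set P : A := ⟨avg p N, avg_mem N (leftReg_mem hPM)⟩ with hP
  have hPP : P * P = P := Subtype.ext (avg_mul_avg N)
  have hcomm : ∀ T : A, P * T = T * P := fun T => Subtype.ext (avg_commute hp N (hCV T.2)).symm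
  -- As `P` is idempotent, `A P` is the set of `T` with `T P = T`, a form in which weak*-closedness
  -- is visible.
  let I : TwoSidedIdeal A := TwoSidedIdeal.mk' {T | T * P = T} (zero_mul _)
    (fun {x y} hx hy => by
      change (x + y) * P = x + y
      rw [add_mul, show x * P = x from hx, show y * P = y from hy])
    (fun {x} hx => by
      exact (neg_mul x P).trans (congrArg Neg.neg hx))
    (fun {x y} hy => by
      change x * y * P = x * y
      rw [mul_assoc, show y * P = y from hy])
    (fun {x y} hx => by
      change x * y * P = x * y
      rw [mul_assoc, ← hcomm, ← mul_assoc, show x * P = x from hx])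
  have hI : ∀ T : A, T ∈ I ↔ T * P = T := fun T => TwoSidedIdeal.mem_mk' _ _ _ _ _ _ _
  refine ⟨P, rfl, hPP, hcomm, I, fun T => ?_, ?_, ?_, ?_⟩
  · rw [hI]
    refine ⟨fun h => ⟨T, h.symm⟩, ?_⟩
    rintro ⟨S, rfl⟩
    rw [mul_assoc, hPP]
  · have : (fun T : A => (T : Op p G)) '' (I : Set A) =
        (A : Set (Op p G)) ∩ {T | T * avg p N = T} := by
      ext T
      constructor
      · rintro ⟨S, hS, rfl⟩
        exact ⟨S.2, congrArg Subtype.val ((hI S).1 hS)⟩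
      · rintro ⟨hT, hTP⟩
        exact ⟨⟨T, hT⟩, (hI _).2 (Subtype.ext hTP), rfl⟩
    rw [IsWeakStarClosedIdeal, this]
    exact @IsClosed.inter _ _ _ (weakStar p G) hA (isClosed_weakStar_mul_right_eq _)
  · intro h
    have h1 : P = 0 := by
      rw [← TwoSidedIdeal.mem_bot, ← h, hI, hPP]
    have h2 := avg_apply_delta (p := p) N 1
    rw [show avg p N = 0 from congrArg Subtype.val h1] at h2
    exact (inv_ne_zero (Nat.cast_ne_zero.2 (Nat.card_pos (α := N)).ne')) h2.symm
  · intro h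
    have h1 : P = 1 := by
      have : (1 : A) ∈ I := h ▸ TwoSidedIdeal.mem_top _
      simpa using (hI 1).1 this
    obtain ⟨s, hs1⟩ := Subgroup.ne_bot_iff_exists_ne_one.1 hN
    have h2 := avg_apply_delta (p := p) N s
    rw [show avg p N = 1 from congrArg Subtype.val h1] at h2
    change delta p (1 : G) (s : G) = _ at h2
    rw [delta_apply_of_ne (by simpa using hs1)] at h2
    exact (inv_ne_zero (Nat.cast_ne_zero.2 (Nat.card_pos (α := N)).ne')) h2.symm

end Average

/-! ### Normal subgroups of groups that are not ICC. -/

section FCCentre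

theorem exists_mulEquiv_of_fg_of_torsionFree (Z : Type*) [CommGroup Z] [Group.FG Z]
    [Nontrivial Z] (htf : ∀ z : Z, IsOfFinOrder z → z = 1) :
    ∃ n, 0 < n ∧ Nonempty (Z ≃* Multiplicative (Fin n → ℤ)) := by
  have : IsMulTorsionFree Z := CommGroup.isMulTorsionFree_iff_torsion_eq_bot.2 <|
    (Subgroup.eq_bot_iff_forall _).2 fun z hz => htf z hz
  have : Module.Finite ℤ (Additive Z) := Module.Finite.iff_addGroup_fg.2 inferInstance
  have : Module.Free ℤ (Additive Z) := inferInstance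
  refine ⟨Module.finrank ℤ (Additive Z), Module.finrank_pos, ⟨?_⟩⟩
  exact AddEquiv.toMultiplicativeRight (Module.finBasis ℤ (Additive Z)).equivFun.toAddEquiv

variable {G : Type*} [Group G]

theorem mem_fcCentre_iff {g : G} : g ∈ fcCentre G ↔ (Subgroup.centralizer {g}).FiniteIndex :=
  finiteIndex_centralizer_iff.symm

/-- A group which is not ICC has a non-trivial normal subgroup which is finite, or is free abelian
of finite rank and contained in the FC-centre. -/
theorem exists_normal_of_not_isICC (hG : ¬ IsICC G) :
    (∃ N : Subgroup G, Finite N ∧ N.Normal ∧ N ≠ ⊥) ∨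
      ∃ (N : Subgroup G) (n : ℕ), 0 < n ∧ N.Normal ∧ (N : Set G) ⊆ fcCentre G ∧
        Nonempty (N ≃* Multiplicative (Fin n → ℤ)) := by
  by_cases hfin : ∃ N : Subgroup G, Finite N ∧ N.Normal ∧ N ≠ ⊥
  · exact Or.inl hfin
  right
  push Not at hfin
  simp only [IsICC, not_forall, Set.not_infinite] at hG
  obtain ⟨g, hg1, hg⟩ := hG
  set H := Subgroup.closure (conjugatesOf g) with hH
  have hHn : H.Normal := by
    have : H = Subgroup.normalClosure {g} := by
      rw [hH, Subgroup.normalClosure, Group.conjugatesOfSet]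
      simp
    rw [this]
    infer_instance
  have hgH : g ∈ H := Subgroup.subset_closure (mem_conjugatesOf_self)
  have hHfg : Group.FG H := (Group.fg_iff_subgroup_fg H).2 ⟨hg.toFinset, by simp [hH]⟩
  set C := Subgroup.centralizer (H : Set G) with hC
  -- `H` is generated by finitely many elements with finite conjugacy classes, so its centralizer is
  -- a finite intersection of subgroups of finite index.
  have hCfi : C.FiniteIndex := by
    have : C = ⨅ x : conjugatesOf g, Subgroup.centralizer {(x : G)} := by
      rw [hC, hH, Subgroup.centralizer_closure, Subgroup.centralizer_eq_iInf, iInf_subtype]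
    rw [this]
    have := hg.to_subtype
    refine Subgroup.finiteIndex_iInf fun x => finiteIndex_centralizer_iff.2 ?_
    rwa [← isConj_iff_conjugatesOf_eq.1 x.2]
  set Z := H ⊓ C with hZ
  have hZn : Z.Normal := inferInstance
  -- `Z` is the centre of `H`, so `C` centralizes it.
  have hZfc : (Z : Set G) ⊆ fcCentre G := fun z hz => by
    refine mem_fcCentre_iff.2 (Subgroup.finiteIndex_of_le (H := C) ?_)
    exact Subgroup.centralizer_le (Set.singleton_subset_iff.2 hz.1)
  have hcomm : ∀ a b : Z, a * b = b * a := fun a b =>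
    Subtype.ext (Subgroup.mem_centralizer_iff.1 a.2.2 b b.2.1).symm
  let _ : CommGroup Z := { (inferInstance : Group Z) with mul_comm := hcomm }
  have hZH : (Z.subgroupOf H).FiniteIndex := by
    rw [hZ, Subgroup.inf_subgroupOf_left]
    infer_instance
  have hZfg : Group.FG Z := by
    have : Group.FG (Z.subgroupOf H) := Subgroup.fg_of_index_ne_zero _
    exact Group.fg_of_surjective
      (f := (Subgroup.subgroupOfEquivOfLe (inf_le_left : Z ≤ H)).toMonoidHom)
      (Subgroup.subgroupOfEquivOfLe (inf_le_left : Z ≤ H)).surjective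
  -- A trivial `Z` of finite index would make `H` a finite normal subgroup containing `g ≠ 1`.
  have hZnt : Nontrivial Z := by
    by_contra hnt
    rw [not_nontrivial_iff_subsingleton] at hnt
    have hbot : Z.subgroupOf H = ⊥ := by
      rw [Subgroup.eq_bot_of_subsingleton Z, Subgroup.bot_subgroupOf]
    rw [hbot] at hZH
    have : Finite H := by
      have := hZH.index_ne_zero
      rw [Subgroup.index_bot] at this
      exact Nat.finite_of_card_ne_zero this
    exact hg1 (by simpa [hfin H this hHn] using hgH)
  -- The conjugates of a torsion element of `Z` are finitely many torsion elements of the abelian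
  -- group `Z`. They generate a finite normal subgroup of `G`, which is trivial by assumption.
  have htf : ∀ z : Z, IsOfFinOrder z → z = 1 := by
    intro z hz
    set N := Subgroup.closure (conjugatesOf (z : G)) with hN
    have hNn : N.Normal := by
      have : N = Subgroup.normalClosure {(z : G)} := by
        rw [hN, Subgroup.normalClosure, Group.conjugatesOfSet]
        simp
      rw [this]
      infer_instance
    have hNT : N ≤ (CommGroup.torsion Z).map Z.subtype := by
      rw [hN, Subgroup.closure_le]
      intro y hy
      obtain ⟨c, rfl⟩ := isConj_iff.1 (show IsConj (z : G) y from hy)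
      refine ⟨⟨c * z * c⁻¹, hZn.conj_mem _ z.2 c⟩, ?_, rfl⟩
      have h1 : IsOfFinOrder (MulAut.conj c (z : G)) :=
        (MulAut.conj c).toMonoidHom.isOfFinOrder (Submonoid.isOfFinOrder_coe.2 hz)
      exact Submonoid.isOfFinOrder_coe.1 h1
    have hNcomm : ∀ a b : N, a * b = b * a := fun a b => by
      obtain ⟨a', -, ha⟩ := hNT a.2
      obtain ⟨b', -, hb⟩ := hNT b.2
      refine Subtype.ext ?_
      change (a : G) * b = b * a
      rw [← ha, ← hb, ← map_mul, hcomm, map_mul]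
    let _ : CommGroup N := { (inferInstance : Group N) with mul_comm := hNcomm }
    have hNfg : Group.FG N := (Group.fg_iff_subgroup_fg N).2
      ⟨(show (conjugatesOf (z : G)).Finite from hZfc z.2).toFinset, by simp [hN]⟩
    have hNfin : Finite N := CommGroup.finite_of_fg_isMulTorsion N fun a => by
      obtain ⟨a', ha', ha⟩ := hNT a.2
      rw [← Submonoid.isOfFinOrder_coe, ← ha]
      exact Submonoid.isOfFinOrder_coe.2 ha'
    have hzN : (z : G) ∈ N := Subgroup.subset_closure (mem_conjugatesOf_self)
    rw [hfin N hNfin hNn] at hzN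
    exact Subtype.ext (Subgroup.mem_bot.1 hzN)
  obtain ⟨n, hn, hiso⟩ := exists_mulEquiv_of_fg_of_torsionFree Z htf
  exact ⟨Z, n, hn, hZn, hZfc, hiso⟩

end FCCentre

/-! ### The inclusion of `CV_p(N)` into `CV_p(G)`. -/

section ExtensionHom

variable {p : ℝ≥0∞} [Fact (1 ≤ p)] {G : Type*} [Group G]

/-- Restriction to a coset intertwines the extension with `S`; multiplicativity and injectivity of
the inclusion both follow. -/
theorem slice_extendOp (hp : p ≠ ∞) (N : Subgroup G) (S : CV p N) (x : Ell p G) (t : G) :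
    slice p N t (extendOp hp N S x) = (S : Op p N) (slice p N t x) := by
  ext u
  rw [slice_apply, extendOp_apply_mul]

/-- The inclusion `CV_p(N) → CV_p(G)` as a homomorphism of algebras. -/
def extendHom (hp : p ≠ ∞) (N : Subgroup G) : CV p N →ₐ[ℂ] CV p G where
  toFun := extend hp N
  map_one' := by
    refine Subtype.ext (ContinuousLinearMap.ext fun x => lp.ext (funext fun g => ?_))
    change x ((1 : N) * g) = x g
    simp
  map_mul' S T := by
    refine Subtype.ext (ContinuousLinearMap.ext fun x => lp.ext (funext fun g => ?_))
    change (S : Op p N) ((T : Op p N) (slice p N g x)) 1 =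
      (S : Op p N) (slice p N g (extendOp hp N T x)) 1
    rw [slice_extendOp]
  map_zero' := Subtype.ext (ContinuousLinearMap.ext fun x => lp.ext (funext fun g => rfl))
  map_add' S T := Subtype.ext (ContinuousLinearMap.ext fun x => lp.ext (funext fun g => rfl))
  commutes' c := by
    refine Subtype.ext (ContinuousLinearMap.ext fun x => lp.ext (funext fun g => ?_))
    change c * x ((1 : N) * g) = c * x g
    simp

theorem norm_extendOp_le (hp : p ≠ ∞) (N : Subgroup G) (S : CV p N) :
    ‖extendOp hp N S‖ ≤ ‖S‖ := by
  rw [extendOp]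
  exact LinearMap.mkContinuous_norm_le _ (norm_nonneg _) _

/-- The inclusion `CV_p(N) → CV_p(G)` as a bounded linear map. -/
def extendL (hp : p ≠ ∞) (N : Subgroup G) : CV p N →L[ℂ] CV p G :=
  (extendHom hp N).toLinearMap.mkContinuous 1 fun S => by
    rw [one_mul]
    exact norm_extendOp_le hp N S

theorem slice_delta (N : Subgroup G) : slice p N 1 (delta p 1) = delta p 1 := by
  ext u
  rw [slice_apply, mul_one]
  by_cases hu : u = 1
  · rw [hu, Subgroup.coe_one, delta_apply_self, delta_apply_self]
  · rw [delta_apply_of_ne hu, delta_apply_of_ne (by simpa using hu)]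

theorem extend_injective (hp : p ≠ ∞) (N : Subgroup G) {S : CV p N} (h : extend hp N S = 0) :
    S = 0 := by
  refine Subtype.ext (CV_ext hp S.2 (zero_mem _) ?_)
  have h1 := slice_extendOp hp N S (delta p 1) 1
  rw [slice_delta, show extendOp hp N S = 0 from congrArg Subtype.val h] at h1
  exact h1.symm.trans (map_zero _)

theorem extendOp_leftReg (hp : p ≠ ∞) (N : Subgroup G) (u : N) :
    extendOp hp N ⟨leftReg p u, leftReg_mem_CV u⟩ = leftReg p (u : G) := by
  ext x g
  change x (((u⁻¹ * 1 : N) : G) * g) = x ((u : G)⁻¹ * g)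
  simp

/-- The operator `∑ f(k) λ_p(t_k)` as an element of `CV_p(G)`. -/
def leftSumCV (p : ℝ≥0∞) [Fact (1 ≤ p)] {ι : Type*} {f : ι → ℂ} (hf : Summable fun k => ‖f k‖)
    (t : ι → G) : CV p G :=
  ⟨leftSum p f t, leftSum_mem_CV hf t⟩

theorem extendOp_leftSum (hp : p ≠ ∞) (N : Subgroup G) {ι : Type*} {f : ι → ℂ}
    (hf : Summable fun k => ‖f k‖) (t : ι → N) :
    extendOp hp N (leftSumCV p hf t) = leftSum p f fun k => (t k : G) := by
  have h1 : HasSum (fun k => f k • (⟨leftReg p (t k), leftReg_mem_CV _⟩ : CV p N))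
      (leftSumCV p hf t) := by
    rw [← (Topology.IsInducing.subtypeVal.hasSum_iff (g := (CV p N).val))]
    exact hasSum_leftSum hf t
  have h2 := ((h1.mapL (extendL hp N)).mapL (CV p G).toSubmodule.subtypeL)
  refine h2.unique ?_
  refine (hasSum_leftSum hf fun k => (t k : G)).congr_fun fun k => ?_
  rw [map_smul, map_smul]
  congr 1
  exact extendOp_leftReg hp N (t k)

end ExtensionHom

/-! ### A central element and the annihilator ideal for free abelian `N`. -/

section CentralElement

variable {p : ℝ≥0∞} [Fact (1 ≤ p)]

theorem leftSum_commute_of_comm {N ι : Type*} [Group N] (hp : p ≠ ∞)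
    (hN : ∀ a b : N, a * b = b * a) {f : ι → ℂ} (hf : Summable fun k => ‖f k‖) (t : ι → N)
    (T : CV p N) : T * leftSumCV p hf t = leftSumCV p hf t * T := by
  refine Subtype.ext (commute_of_mem_biRegular hp (leftSum_mem_biRegular hf t) (fun g => ?_) T.2)
  rw [leftReg_mul_leftSum hf]
  simp [hN g]

/-- The operator `∑ f(k) λ_p(c^k)` as a central element of `CV_p(N)`, for `N` abelian. -/
def centralSum {N : Type*} [Group N] (hp : p ≠ ∞) (hN : ∀ a b : N, a * b = b * a) {f : ℤ → ℂ}
    (hf : Summable fun k => ‖f k‖) (c : N) : Subalgebra.center ℂ (CV p N) :=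
  ⟨leftSumCV p hf fun k => c ^ k,
    Subalgebra.mem_center_iff.2 fun T => leftSum_commute_of_comm hp hN hf _ T⟩

/-- Each partial product is an absolutely summable combination of translations with coefficient sum
`1`, a property preserved by multiplication. Such an operator cannot vanish. -/
theorem prod_centralSum_ne_zero {N : Type*} [Group N] (hp : p ≠ ∞) (hN : ∀ a b : N, a * b = b * a)
    {f : ℤ → ℂ} (hf : Summable fun k => ‖f k‖) (hf1 : ∑' k, f k = 1) (C : Finset N) :
    ((∏ c ∈ C, centralSum hp hN hf c : Subalgebra.center ℂ (CV p N)) : CV p N) ≠ 0 := by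
  have key : ∃ (ι : Type) (φ : ι → ℂ) (t : ι → N), (Summable fun i => ‖φ i‖) ∧ ∑' i, φ i = 1 ∧
      (((∏ c ∈ C, centralSum hp hN hf c : Subalgebra.center ℂ (CV p N)) : CV p N) : Op p N) =
        leftSum p φ t := by
    refine Finset.prod_induction (centralSum hp hN hf) (fun x => ∃ (ι : Type) (φ : ι → ℂ)
      (t : ι → N), (Summable fun i => ‖φ i‖) ∧ ∑' i, φ i = 1 ∧
        ((x : CV p N) : Op p N) = leftSum p φ t) ?_ ?_ ?_
    · rintro x y ⟨ι, φ, t, hφ, hφ1, hx⟩ ⟨κ, ψ, s, hψ, hψ1, hy⟩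
      refine ⟨ι × κ, fun z => φ z.1 * ψ z.2, fun z => t z.1 * s z.2, hφ.mul_norm hψ, ?_, ?_⟩
      · rw [← tsum_mul_tsum_of_summable_norm hφ hψ, hφ1, hψ1, one_mul]
      · rw [← leftSum_mul hφ hψ t s, ← hx, ← hy]
        rfl
    · refine ⟨Unit, fun _ => 1, fun _ => 1, (hasSum_fintype _).summable, by simp, ?_⟩
      simp [leftSum, leftReg_one]
    · exact fun c _ => ⟨ℤ, f, fun k => c ^ k, hf, hf1, rfl⟩
  obtain ⟨ι, φ, t, hφ, hφ1, h⟩ := key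
  intro h0
  rw [h0] at h
  exact one_ne_zero (hφ1.symm.trans (tsum_eq_zero_of_leftSum_eq_zero hφ h.symm))

variable {G : Type*} [Group G] {N : Subgroup G}

theorem extendOp_one (hp : p ≠ ∞) (N : Subgroup G) : extendOp hp N 1 = 1 :=
  congrArg Subtype.val (map_one (extendHom hp N))

theorem extendOp_mul (hp : p ≠ ∞) (S T : CV p N) :
    extendOp hp N (S * T) = extendOp hp N S * extendOp hp N T :=
  congrArg Subtype.val (map_mul (extendHom hp N) S T)

theorem extendOp_centralSum (hp : p ≠ ∞) (hN : ∀ a b : N, a * b = b * a) {f : ℤ → ℂ}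
    (hf : Summable fun k => ‖f k‖) (c : N) :
    extendOp hp N (centralSum hp hN hf c : CV p N) = leftSum p f fun k => (c : G) ^ k :=
  (extendOp_leftSum hp N hf fun k : ℤ => c ^ k).trans (by simp)

/-- Serves twice: with `B = A` to place the product in the algebra, and with `B = biRegular p G` to
make it central. -/
theorem extendOp_prod_mem (hp : p ≠ ∞) (hN : ∀ a b : N, a * b = b * a) {f : ℤ → ℂ}
    (hf : Summable fun k => ‖f k‖) (C : Finset N) {B : Subalgebra ℂ (Op p G)}
    (hB : ∀ c : N, leftSum p f (fun k => (c : G) ^ k) ∈ B) :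
    extendOp hp N ((∏ c ∈ C, centralSum hp hN hf c : Subalgebra.center ℂ (CV p N)) : CV p N)
      ∈ B := by
  refine Finset.prod_induction (centralSum hp hN hf)
    (fun x => extendOp hp N (x : CV p N) ∈ B) (fun x y hx hy => ?_) ?_ fun c _ => ?_
  · rw [MulMemClass.coe_mul, extendOp_mul]
    exact mul_mem hx hy
  · rw [OneMemClass.coe_one, extendOp_one]
    exact one_mem _
  · rw [extendOp_centralSum]
    exact hB c

theorem leftReg_mul_extendOp_prod [N.Normal] (hp : p ≠ ∞) (hN : ∀ a b : N, a * b = b * a)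
    {f : ℤ → ℂ} (hf : Summable fun k => ‖f k‖) (g : G) (C : Finset N) :
    leftReg p g * extendOp hp N
        ((∏ c ∈ C, centralSum hp hN hf c : Subalgebra.center ℂ (CV p N)) : CV p N) =
      extendOp hp N ((∏ c ∈ C, centralSum hp hN hf (MulAut.conjNormal g c) :
        Subalgebra.center ℂ (CV p N)) : CV p N) * leftReg p g := by
  classical
  induction C using Finset.induction_on with
  | empty => rw [Finset.prod_empty, Finset.prod_empty, OneMemClass.coe_one, extendOp_one, one_mul,
      mul_one]
  | insert c C hc ih =>
    rw [Finset.prod_insert hc, Finset.prod_insert hc, MulMemClass.coe_mul, MulMemClass.coe_mul,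
      extendOp_mul, extendOp_mul, mul_assoc, ← ih, ← mul_assoc, ← mul_assoc, extendOp_centralSum,
      extendOp_centralSum, leftReg_mul_leftSum hf]
    simp only [MulAut.conjNormal_apply, conj_zpow]

/-- The ideal of `CV_p(N)` annihilated by a central element. -/
def annIdeal {N : Type*} [Group N] (W : Subalgebra.center ℂ (CV p N)) : Ideal (CV p N) where
  carrier := {v | (W : CV p N) * v = 0}
  add_mem' {v w} hv hw := by
    change (W : CV p N) * (v + w) = 0
    rw [mul_add, show (W : CV p N) * v = 0 from hv, show (W : CV p N) * w = 0 from hw, add_zero]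
  zero_mem' := mul_zero _
  smul_mem' S v hv := by
    change (W : CV p N) * (S * v) = 0
    rw [← mul_assoc, ← Subalgebra.mem_center_iff.1 W.2 S, mul_assoc,
      show (W : CV p N) * v = 0 from hv, mul_zero]

theorem isClosed_annIdeal {N : Type*} [Group N] (W : Subalgebra.center ℂ (CV p N)) :
    IsClosed (annIdeal W : Set (CV p N)) :=
  isClosed_eq (f := fun v => (W : CV p N) * v) (continuous_const.mul continuous_id)
    continuous_const

/-- This right action on the homomorphisms makes the annihilator absorb multiplication from the
left. -/
theorem mul_mem_HomCV (hp : p ≠ ∞) {K : Ideal (CV p N)} {Φ : K →L[ℂ] CV p G}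
    (hΦ : Φ ∈ HomCV hp N K) (S : CV p G) :
    ((ContinuousLinearMap.mul ℂ (CV p G)).flip S).comp Φ ∈ HomCV hp N K := fun R v => by
  change Φ _ * S = extend hp N R * (Φ v * S)
  rw [hΦ R v, mul_assoc]

/-- The annihilator of `Hom_{CV_p(N)}(K, CV_p(G))` in `A`, as a two-sided ideal. -/
def annHomIdeal (hp : p ≠ ∞) {A : Subalgebra ℂ (Op p G)} (hCV : A ≤ CV p G) (N : Subgroup G)
    (K : Ideal (CV p N)) : TwoSidedIdeal A :=
  TwoSidedIdeal.mk' {T | (⟨T, hCV T.2⟩ : CV p G) ∈ annHomCV hp N K}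
    (fun Φ _ v => mul_zero (Φ v))
    (fun {x y} hx hy Φ hΦ v => by
      have h := mul_add (Φ v) ⟨x, hCV x.2⟩ ⟨y, hCV y.2⟩
      rw [hx Φ hΦ v, hy Φ hΦ v, add_zero] at h
      exact h)
    (fun {x} hx Φ hΦ v => by
      have h := mul_neg (Φ v) ⟨x, hCV x.2⟩
      rw [hx Φ hΦ v, neg_zero] at h
      exact h)
    (fun {x y} hy Φ hΦ v => by
      have h := hy _ (mul_mem_HomCV hp hΦ ⟨x, hCV x.2⟩) v
      exact (mul_assoc (Φ v) ⟨x, hCV x.2⟩ ⟨y, hCV y.2⟩).symm.trans h)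
    (fun {x y} hx Φ hΦ v => by
      have h := mul_assoc (Φ v) ⟨x, hCV x.2⟩ ⟨y, hCV y.2⟩
      rw [hx Φ hΦ v, zero_mul] at h
      exact h.symm)

theorem mem_annHomIdeal (hp : p ≠ ∞) {A : Subalgebra ℂ (Op p G)} (hCV : A ≤ CV p G)
    (K : Ideal (CV p N)) (T : A) :
    T ∈ annHomIdeal hp hCV N K ↔ (⟨T, hCV T.2⟩ : CV p G) ∈ annHomCV hp N K :=
  TwoSidedIdeal.mem_mk' _ _ _ _ _ _ _

theorem isWeakStarClosedIdeal_annHomIdeal (hp₁ : 1 < p) (hp : p ≠ ∞) {A : Subalgebra ℂ (Op p G)}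
    (hA : IsClosed[weakStar p G] (A : Set (Op p G))) (hCV : A ≤ CV p G) (K : Ideal (CV p N)) :
    IsWeakStarClosedIdeal (annHomIdeal hp hCV N K) := by
  have : (fun T : A => (T : Op p G)) '' (annHomIdeal hp hCV N K : Set A) =
      (A : Set (Op p G)) ∩ ⋂ (Φ : HomCV hp N K) (v : K),
        {T | ((Φ : K →L[ℂ] CV p G) v : Op p G) * T = 0} := by
    ext T
    constructor
    · rintro ⟨S, hS, rfl⟩
      refine ⟨S.2, Set.mem_iInter₂.2 fun Φ v => ?_⟩
      exact congrArg Subtype.val ((mem_annHomIdeal hp hCV K S).1 hS Φ Φ.2 v)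
    · rintro ⟨hT, h⟩
      refine ⟨⟨T, hT⟩, (mem_annHomIdeal hp hCV K _).2 fun Φ hΦ v => Subtype.ext ?_, rfl⟩
      exact Set.mem_iInter₂.1 h ⟨Φ, hΦ⟩ v
  rw [IsWeakStarClosedIdeal, this]
  exact @IsClosed.inter _ _ _ (weakStar p G) hA (@isClosed_iInter _ _ (weakStar p G) _ fun Φ =>
    @isClosed_iInter _ _ (weakStar p G) _ fun v => isClosed_weakStar_mul_left_eq_zero hp₁ hp _)

/-- The inclusion `K → CV_p(G)`, an element of `Hom_{CV_p(N)}(K, CV_p(G))`. -/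
def inclusionHom (hp : p ≠ ∞) (N : Subgroup G) (K : Ideal (CV p N)) : K →L[ℂ] CV p G where
  toFun v := extend hp N v
  map_add' v w := map_add (extendHom hp N) (v : CV p N) w
  map_smul' c v := map_smul (extendHom hp N) c (v : CV p N)
  cont := (extendL hp N).continuous.comp continuous_subtype_val

theorem inclusionHom_mem (hp : p ≠ ∞) (K : Ideal (CV p N)) :
    inclusionHom hp N K ∈ HomCV hp N K :=
  fun S v => map_mul (extendHom hp N) S (v : CV p N)

theorem annHomIdeal_ne_top (hp : p ≠ ∞) {A : Subalgebra ℂ (Op p G)} (hCV : A ≤ CV p G)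
    {K : Ideal (CV p N)} (hK : K ≠ ⊥) : annHomIdeal hp hCV N K ≠ ⊤ := by
  obtain ⟨v, hv, hv0⟩ := Submodule.exists_mem_ne_zero_of_ne_bot hK
  intro h
  have h1 : (1 : A) ∈ annHomIdeal hp hCV N K := h ▸ TwoSidedIdeal.mem_top _
  have h2 := (mem_annHomIdeal hp hCV K 1).1 h1 _ (inclusionHom_mem hp K) ⟨v, hv⟩
  exact hv0 (extend_injective hp N ((mul_one _).symm.trans h2))

theorem annHomIdeal_annIdeal_ne_bot (hp : p ≠ ∞) {A : Subalgebra ℂ (Op p G)} (hCV : A ≤ CV p G)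
    {W : Subalgebra.center ℂ (CV p N)} (hW : (W : CV p N) ≠ 0)
    (hWA : extendOp hp N (W : CV p N) ∈ A)
    (hWc : ∀ T ∈ CV p G, T * extendOp hp N (W : CV p N) = extendOp hp N (W : CV p N) * T) :
    annHomIdeal hp hCV N (annIdeal W) ≠ ⊥ := by
  intro h
  have hmem : (⟨_, hWA⟩ : A) ∈ annHomIdeal hp hCV N (annIdeal W) := by
    rw [mem_annHomIdeal]
    intro Φ hΦ v
    have h1 : Φ v * extend hp N (W : CV p N) = extend hp N (W : CV p N) * Φ v :=
      Subtype.ext (hWc _ (Φ v).2)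
    refine h1.trans ((hΦ _ v).symm.trans ?_)
    have h2 : (⟨(W : CV p N) * v, (annIdeal W).mul_mem_left _ v.2⟩ : annIdeal W) = 0 :=
      Subtype.ext (show (W : CV p N) * v = 0 from v.2)
    rw [h2]
    exact Φ.map_zero
  rw [h, TwoSidedIdeal.mem_bot] at hmem
  exact hW (extend_injective hp N (Subtype.ext (show extendOp hp N _ = 0 from congrArg Subtype.val hmem)))

theorem exists_ideal_of_free_abelian (hp₁ : 1 < p) (hp : p ≠ ∞) {A : Subalgebra ℂ (Op p G)}
    (hA : IsClosed[weakStar p G] (A : Set (Op p G)))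
    (hPM : PM p G ⊆ (A : Set (Op p G))) (hCV : A ≤ CV p G) [N.Normal]
    (hNfc : (N : Set G) ⊆ fcCentre G) (hN : ∀ a b : N, a * b = b * a) {s : N}
    (hs : Function.Injective fun k : ℤ => s ^ k) :
    ∃ K : Ideal (CV p N), IsClosed (K : Set (CV p N)) ∧
      ∃ I : TwoSidedIdeal A,
        (∀ T : A, T ∈ I ↔ (⟨T, hCV T.2⟩ : CV p G) ∈ annHomCV hp N K) ∧
        IsWeakStarClosedIdeal I ∧ I ≠ ⊥ ∧ I ≠ ⊤ := by
  classical
  obtain ⟨f, h, hf, hh, hf1, ⟨m, hm⟩, hfh⟩ := exists_summable_convolution_eq_zero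
  have hfin : (Subtype.val ⁻¹' conjugatesOf (s : G) : Set N).Finite :=
    Set.Finite.preimage Subtype.val_injective.injOn (hNfc s.2)
  set C : Finset N := hfin.toFinset with hC
  have hmemC : ∀ c : N, c ∈ C ↔ IsConj (s : G) c := fun c => hfin.mem_toFinset
  set W : Subalgebra.center ℂ (CV p N) := ∏ c ∈ C, centralSum hp hN hf c with hW
  have hWA : extendOp hp N (W : CV p N) ∈ A := extendOp_prod_mem hp hN hf C fun c =>
    leftSum_mem (isClosed_of_isClosed_weakStar hA) hf fun k => leftReg_mem hPM _
  have hWb : extendOp hp N (W : CV p N) ∈ biRegular p G :=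
    extendOp_prod_mem hp hN hf C fun c => leftSum_mem_biRegular hf _
  have hWl : ∀ g : G, leftReg p g * extendOp hp N (W : CV p N) =
      extendOp hp N (W : CV p N) * leftReg p g := fun g => by
    rw [hW, leftReg_mul_extendOp_prod hp hN hf g C]
    congr 3
    -- Conjugation by `g` permutes the conjugacy class `C`. The factors are taken in the centre of
    -- `CV_p(N)`, a commutative ring, so their order is immaterial.
    refine Finset.prod_bijective (MulAut.conjNormal g : MulAut N) (MulEquiv.bijective _)
      (fun c => ?_) fun _ _ => rfl
    rw [hmemC, hmemC, MulAut.conjNormal_apply]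
    have : IsConj (c : G) (g * c * g⁻¹) := isConj_iff.2 ⟨g, rfl⟩
    exact ⟨fun h => h.trans this, fun h => h.trans this.symm⟩
  refine ⟨annIdeal W, isClosed_annIdeal W, annHomIdeal hp hCV N (annIdeal W),
    mem_annHomIdeal hp hCV _, isWeakStarClosedIdeal_annHomIdeal hp₁ hp hA hCV _,
    annHomIdeal_annIdeal_ne_bot hp hCV (prod_centralSum_ne_zero hp hN hf hf1 C) hWA
      fun T hT => commute_of_mem_biRegular hp hWb hWl hT, annHomIdeal_ne_top hp hCV ?_⟩
  have hv : leftSumCV p hh (fun k => s ^ k) ∈ annIdeal W := by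
    change (W : CV p N) * leftSumCV p hh (fun k => s ^ k) = 0
    have hsC : s ∈ C := (hmemC s).2 (IsConj.refl _)
    -- The factor at `c = s` alone annihilates the element built from `h`, so the whole product
    -- does.
    rw [hW, ← Finset.prod_erase_mul _ _ hsC]
    have h0 : (centralSum hp hN hf s : CV p N) * leftSumCV p hh (fun k => s ^ k) = 0 :=
      Subtype.ext (leftSum_zpow_mul_eq_zero hf hh hfh s)
    change (_ * _ : CV p N) * _ = 0
    rw [mul_assoc, h0, mul_zero]
  intro hbot
  rw [hbot, Submodule.mem_bot] at hv
  have := leftSum_zpow_apply_delta (p := p) hh hs m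
  rw [show leftSum p h (fun k => s ^ k) = 0 from congrArg Subtype.val hv] at this
  exact hm this.symm

end CentralElement

end ConvOp

end

theorem theorem3p8 {G : Type*} [Group G] (p : ℝ≥0∞) [Fact (1 ≤ p)] (hp₁ : 1 < p) (hp : p ≠ ∞)
    (A : Subalgebra ℂ (ConvOp.Op p G))
    (hA : IsClosed[ConvOp.weakStar p G] (A : Set (ConvOp.Op p G)))
    (hPM : ConvOp.PM p G ⊆ (A : Set (ConvOp.Op p G))) (hCV : A ≤ ConvOp.CV p G) :
    (ConvOp.IsWeakStarSimple A ↔ ConvOp.IsICC G) ∧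
    (¬ ConvOp.IsICC G →
      (∃ N : Subgroup G, Finite N ∧ N.Normal ∧ N ≠ ⊥ ∧
        ∃ P : A, (P : ConvOp.Op p G) = ConvOp.avg p N ∧ P * P = P ∧ (∀ T : A, P * T = T * P) ∧
          ∃ I : TwoSidedIdeal A, (∀ T : A, T ∈ I ↔ ∃ S : A, T = S * P) ∧
            ConvOp.IsWeakStarClosedIdeal I ∧ I ≠ ⊥ ∧ I ≠ ⊤) ∨
      (∃ (N : Subgroup G) (n : ℕ), 0 < n ∧ N.Normal ∧ (N : Set G) ⊆ ConvOp.fcCentre G ∧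
        Nonempty (N ≃* Multiplicative (Fin n → ℤ)) ∧
        ∃ K : Ideal (ConvOp.CV p N), IsClosed (K : Set (ConvOp.CV p N)) ∧
          ∃ I : TwoSidedIdeal A,
            (∀ T : A, T ∈ I ↔ (⟨T, hCV T.2⟩ : ConvOp.CV p G) ∈ ConvOp.annHomCV hp N K) ∧
            ConvOp.IsWeakStarClosedIdeal I ∧ I ≠ ⊥ ∧ I ≠ ⊤)) := by
  refine (fun hmain => ⟨⟨fun hsimple => by_contra fun hG => ?simple,
    fun hG => hG.isWeakStarSimple hp₁ hp hPM hCV⟩, hmain⟩) ?main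
  case simple =>
    rcases hmain hG with ⟨N, -, -, -, P, -, -, -, I, -, hI, hbot, htop⟩ |
      ⟨N, n, -, -, -, -, K, -, I, -, hI, hbot, htop⟩
    · exact (hsimple I hI).elim hbot htop
    · exact (hsimple I hI).elim hbot htop
  case main =>
    intro hG
    rcases ConvOp.exists_normal_of_not_isICC hG with ⟨N, hfin, hn, hN⟩ |
      ⟨N, n, hn0, hn, hfc, ⟨e⟩⟩
    · exact Or.inl ⟨N, hfin, hn, hN, ConvOp.exists_ideal_of_finite_normal hp hA hPM hCV N hN⟩
    · have hcomm : ∀ a b : N, a * b = b * a := fun a b =>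
        e.injective (by rw [map_mul, map_mul, mul_comm])
      -- The chosen `s` corresponds to the vector `(1, …, 1)`. As `n > 0`, its coordinate `0`
      -- recovers the exponent.
      have hs : Function.Injective
          fun k : ℤ => e.symm (Multiplicative.ofAdd fun _ : Fin n => (1 : ℤ)) ^ k := by
        intro k l hkl
        simp only [← map_zpow] at hkl
        have h1 := congrArg Multiplicative.toAdd (e.symm.injective hkl)
        simpa using congrFun h1 ⟨0, hn0⟩
      exact Or.inr ⟨N, n, hn0, hn, hfc, ⟨e⟩,
        ConvOp.exists_ideal_of_free_abelian hp₁ hp hA hPM hCV hfc hcomm hs⟩
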